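/- For positive integers $n,m$ let $T_{n,m}=\mathbb Z/n\mathbb Z\times\mathbb Z/m\mathbb Z$, and define a random map $\phi:T_{n,m}\to T_{n,m}$ by setting $\phi(x,y)$ equal to $(x+1,y)$ or $(x,y+1)$ with probability $1/2$ each, independently over the $nm$ vertices. A cycle of $\phi$ is a periodic orbit of $\phi$, together with the edges chosen at its vertices. A cycle has homology class $(p,q)$ if it crosses every vertical line exactly $p$ times and every horizontal line exactly $q$ times; that is, for every $i\in\mathbb Z/n\mathbb Z$ it contains exactly $p$ horizontal edges $(i,y)\to(i+1,y)$, and for every $j\in\mathbb Z/m\mathbb Z$ it contains exactly $q$ vertical edges $(x,j)\to(x,j+1)$. Let $N_{(p,q)}$ denote the number of cycles of homology class $(p,q)$. Let $p,q\ge 1$ be fixed coprime integers and let $\rho\in(0,\infty)$ be fixed. There are constants $c_0>0$ and $C_0>0$, depending only on $p$, $q$ and $\rho$, such that the following holds for every sequence of natural numbers $m=m(n)$ with $m=(p/q)n+\rho\sqrt n\,(1+o(1))$ as $n\to\infty$. (i) For every $c\in(0,c_0]$ and all sufficiently large $n$, $$\mathbb P\big(\text{every cycle of }\phi\text{ has homology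 class }(p,q)\big)\ \ge\ 1-\exp\{-c\,n^{1/2}\}$$ and $$\mathbb P\big(N_{(p,q)}>c\,n^{1/2}\big)\ \ge\ 1-\exp\{-c\,n^{1/2}\}.$$ (ii) For every $C\ge C_0$ and all sufficiently large $n$, $$\mathbb P\big(N_{(p,q)}>C\,n^{1/2}\big)\ \le\ \exp\{-C^{-1}n^{1/2}\}.$$ Here "sufficiently large" may depend on the sequence $m(n)$ and on $c$, respectively $C$. -/

import Mathlib

open Filter MeasureTheory Asymptotics

/-- The discrete torus `ℤ/nℤ × ℤ/mℤ`. -/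
abbrev Torus (n m : ℕ) : Type := ZMod n × ZMod m

/-- A choice of one outgoing edge at every vertex of the torus: `true` is the edge
`(x, y) → (x + 1, y)` and `false` is the edge `(x, y) → (x, y + 1)`. -/
abbrev EdgeChoice (n m : ℕ) : Type := Torus n m → Bool

/-- The map `φ` of the torus which follows the chosen outgoing edge. -/
def quenchedWalk {n m : ℕ} (ω : EdgeChoice n m) (v : Torus n m) : Torus n m :=
  if ω v = true then (v.1 + 1, v.2) else (v.1, v.2 + 1)

/-- The law of the quenched random walk: the choices at distinct vertices are independent, and
each of them is a fair coin toss. -/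
noncomputable def quenchedLaw (n m : ℕ) : Measure (EdgeChoice n m) :=
  Measure.infinitePi fun _ : Torus n m => (PMF.uniformOfFintype Bool).toMeasure

/-- A cycle (closed orbit) of the walk, as a set of vertices: the orbit of a periodic point. -/
def IsCycleOf {n m : ℕ} (ω : EdgeChoice n m) (S : Set (Torus n m)) : Prop :=
  ∃ v ∈ Function.periodicPts (quenchedWalk ω), S = Set.range fun k : ℕ => (quenchedWalk ω)^[k] v

/-- The cycle `S` has homology class `(p, q)`: it crosses every vertical line (between two
consecutive columns) exactly `p` times and every horizontal line (between two consecutive rows)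
exactly `q` times. Crossings are counted by edges of the cycle, identified with their tails. -/
def HasHomologyClass {n m : ℕ} (ω : EdgeChoice n m) (S : Set (Torus n m)) (p q : ℕ) : Prop :=
  (∀ i : ZMod n, {v ∈ S | v.1 = i ∧ ω v = true}.ncard = p) ∧
    ∀ j : ZMod m, {v ∈ S | v.2 = j ∧ ω v = false}.ncard = q

/-- The number `N_{(p,q)}` of cycles of homology class `(p, q)`. -/
noncomputable def numCycles {n m : ℕ} (p q : ℕ) (ω : EdgeChoice n m) : ℕ :=
  {S : Set (Torus n m) | IsCycleOf ω S ∧ HasHomologyClass ω S p q}.ncard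

/-! Put `L = p * n + q * m`. A walk is determined by its number of horizontal steps. A periodic
vertex lies on a cycle of class `(p, q)` exactly when `p * n` of its first `L` steps are horizontal
and the walk is then back at its start (`ClosesUp`); coprimality makes `L` the minimal period. Two
walks on a common antidiagonal coalesce when they meet and so never cross (`hCount_le_add_hCount`).

One cycle of class `(p, q)` forces the class of all others (`ClosesUp.of_mem_periodicPts`): lifted
to the plane, any walk is squeezed between translates of that cycle, so its horizontal count stays
within bounded distance of the right slope. The first bound in (i) therefore follows from the
second.

Upper tail: distinct cycles are vertex-disjoint, so `k` of them use independent coins. A union bound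
over their starting points in one column gives at most `m.choose k * (L.choose (p * n) / 2 ^ L) ^
k`, which is at most `(O(√n)) ^ k / k!` and hence exponentially small once `k` is a large multiple
of `√n`.

Lower tail: transversally to the geodesic direction the torus has width `n * m / L`, of order `n`.
This leaves room for order `√n` disjoint blocks, each with two tracks of width of order `√L`
drifting towards each other. If the walks from both track centers stay in their tracks, monotonicity
and a discrete intermediate value argument trap a closed walk between them. A track is followed with
probability bounded below, by Kolmogorov's inequality for a tilted coin and a change of measure
whose cost is bounded because `q * m - p * n = O(√n)`. Blocks use disjoint vertices, hence are
independent, and a Chernoff bound finishes. -/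

/-- The number of horizontal edges among the first `t` edges of the walk started from `v`. -/
def hCount {n m : ℕ} (ω : EdgeChoice n m) (v : Torus n m) (t : ℕ) : ℕ :=
  Nat.count (fun i => ω ((quenchedWalk ω)^[i] v) = true) t

/-! ### Horizontal counts, positions and visits to residue classes -/

section Walk

variable {n m : ℕ} (ω : EdgeChoice n m)

theorem hCount_le (v : Torus n m) (t : ℕ) : hCount ω v t ≤ t := Nat.count_le _

@[simp] theorem hCount_zero (v : Torus n m) : hCount ω v 0 = 0 := Nat.count_zero _

theorem hCount_succ (v : Torus n m) (t : ℕ) :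
    hCount ω v (t + 1) = hCount ω v t +
      if ω ((quenchedWalk ω)^[t] v) = true then 1 else 0 := Nat.count_succ _ _

theorem quenchedWalk_iterate (v : Torus n m) (t : ℕ) :
    (quenchedWalk ω)^[t] v =
      (v.1 + (hCount ω v t : ZMod n), v.2 + ((t : ZMod m) - (hCount ω v t : ZMod m))) := by
  induction t with
  | zero => simp
  | succ t ih =>
    rw [Function.iterate_succ_apply', hCount_succ, quenchedWalk]
    split_ifs with h
    · rw [ih]; ext <;> dsimp only <;> push_cast <;> ring
    · rw [ih]; ext <;> simp [add_assoc, sub_add_eq_add_sub]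

theorem hCount_add (v : Torus n m) (s t : ℕ) :
    hCount ω v (s + t) = hCount ω v s + hCount ω ((quenchedWalk ω)^[s] v) t := by
  unfold hCount
  rw [Nat.count_add]
  congr 1
  simp only [← Function.iterate_add_apply]
  congr 1
  ext k
  rw [add_comm]

variable {ω}

theorem iterate_mul_of_closed {v : Torus n m} {P : ℕ} (h : (quenchedWalk ω)^[P] v = v) (j : ℕ) :
    (quenchedWalk ω)^[j * P] v = v :=
  (Function.IsPeriodicPt.const_mul (show Function.IsPeriodicPt _ _ _ from h) j)

theorem hCount_mul {v : Torus n m} {P : ℕ} (h : (quenchedWalk ω)^[P] v = v) (j : ℕ) :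
    hCount ω v (j * P) = j * hCount ω v P := by
  induction j with
  | zero => simp
  | succ j ih => rw [add_mul, hCount_add, iterate_mul_of_closed h, ih, one_mul, add_mul, one_mul]

end Walk

/-- The counter `Nat.count P` increases by one exactly at the times when `P` holds, so at those
times it runs through `0, 1, 2, ...` without repetition. With `count_residue` this counts how often
a cycle crosses a given line. -/
theorem count_and_count (P Q : ℕ → Prop) [DecidablePred P] [DecidablePred Q] (L : ℕ) :
    Nat.count (fun t => P t ∧ Q (Nat.count P t)) L = Nat.count Q (Nat.count P L) := by
  induction L with
  | zero => simp
  | succ L ih =>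
    rw [Nat.count_succ, Nat.count_succ, ih]
    by_cases h : P L
    · simp [h, Nat.count_succ]
    · simp [h]

theorem count_residue {n : ℕ} [NeZero n] (a i : ZMod n) (p : ℕ) :
    Nat.count (fun s : ℕ => a + (s : ZMod n) = i) (p * n) = p := by
  have base : ∀ a : ZMod n, Nat.count (fun s : ℕ => a + (s : ZMod n) = i) n = 1 := by
    intro a
    rw [Nat.count_eq_card_filter_range, Finset.card_eq_one]
    refine ⟨(i - a).val, ?_⟩
    ext s
    simp only [Finset.mem_filter, Finset.mem_range, Finset.mem_singleton]
    constructor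
    · rintro ⟨hs, h⟩
      rw [← h, add_sub_cancel_left, ZMod.val_natCast, Nat.mod_eq_of_lt hs]
    · rintro rfl
      exact ⟨ZMod.val_lt _, by simp⟩
  induction p with
  | zero => simp
  | succ p ih =>
    rw [add_mul, Nat.count_add, ih, one_mul]
    simp [base]

theorem ncard_orbit_sep {n m : ℕ} (ω : EdgeChoice n m) {v : Torus n m}
    (hv : v ∈ Function.periodicPts (quenchedWalk ω)) (R : Torus n m → Prop) [DecidablePred R] :
    {u ∈ Set.range fun k : ℕ => (quenchedWalk ω)^[k] v | R u}.ncard =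
      Nat.count (fun t => R ((quenchedWalk ω)^[t] v))
        (Function.minimalPeriod (quenchedWalk ω) v) := by
  classical
  set P := Function.minimalPeriod (quenchedWalk ω) v
  have hP : 0 < P := Function.minimalPeriod_pos_of_mem_periodicPts hv
  have : {u ∈ Set.range fun k : ℕ => (quenchedWalk ω)^[k] v | R u} =
      (((Finset.range P).filter fun t => R ((quenchedWalk ω)^[t] v)).image
        fun t => (quenchedWalk ω)^[t] v : Finset _) := by
    ext u
    simp only [Set.mem_ofPred_eq, Set.mem_range, Finset.coe_image, Finset.coe_filter,
      Finset.mem_range, Set.mem_image]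
    constructor
    · rintro ⟨⟨k, rfl⟩, h⟩
      refine ⟨k % P, ⟨Nat.mod_lt _ hP, ?_⟩, ?_⟩
      · simpa only [P, Function.iterate_mod_minimalPeriod_eq] using h
      · simp only [P, Function.iterate_mod_minimalPeriod_eq]
    · rintro ⟨t, ⟨-, h⟩, rfl⟩
      exact ⟨⟨t, rfl⟩, h⟩
  rw [this, Set.ncard_coe_finset, Finset.card_image_of_injOn, Nat.count_eq_card_filter_range]
  intro s hs t ht h
  simp only [Finset.coe_filter, Finset.mem_range, Set.mem_ofPred_eq] at hs ht
  exact (Function.iterate_eq_iterate_iff_of_lt_minimalPeriod hs.1 ht.1).1 h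

theorem count_not (P : ℕ → Prop) [DecidablePred P] (t : ℕ) :
    Nat.count P t + Nat.count (fun i => ¬ P i) t = t := by
  induction t with
  | zero => simp
  | succ t ih => rw [Nat.count_succ, Nat.count_succ]; split_ifs <;> omega

/-! ### Closed walks and homology classes -/

section Closed

variable {n m : ℕ} {ω : EdgeChoice n m}

theorem exists_displacement {v : Torus n m} {P : ℕ} (h : (quenchedWalk ω)^[P] v = v) :
    ∃ p q : ℕ, P = p * n + q * m ∧ hCount ω v P = p * n := by
  rw [quenchedWalk_iterate] at h
  have h1 := congrArg Prod.fst h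
  have h2 := congrArg Prod.snd h
  simp only [add_eq_left] at h1 h2
  rw [← Nat.cast_sub (hCount_le _ _ _), ZMod.natCast_eq_zero_iff] at h2
  rw [ZMod.natCast_eq_zero_iff] at h1
  obtain ⟨p, hp⟩ := h1
  obtain ⟨q, hq⟩ := h2
  have := hCount_le ω v P
  refine ⟨p, q, ?_, ?_⟩
  · rw [mul_comm p, mul_comm q]; omega
  · rw [mul_comm p]; omega

/-- The walk from `v` closes up after `p` turns around the torus in the horizontal direction and
`q` turns in the vertical direction. -/
def ClosesUp (ω : EdgeChoice n m) (p q : ℕ) (v : Torus n m) : Prop :=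
  (quenchedWalk ω)^[p * n + q * m] v = v ∧ hCount ω v (p * n + q * m) = p * n

theorem ClosesUp.iterate {p q : ℕ} {v : Torus n m} (h : ClosesUp ω p q v) (t : ℕ) :
    ClosesUp ω p q ((quenchedWalk ω)^[t] v) := by
  obtain ⟨h1, h2⟩ := h
  constructor
  · rw [← Function.iterate_add_apply, add_comm, Function.iterate_add_apply, h1]
  -- The first `t + L` steps are split in two ways, after `t` steps and after a full turn.
  · have e1 := hCount_add ω v t (p * n + q * m)
    have e2 := hCount_add ω v (p * n + q * m) t
    rw [h1, h2, add_comm _ t, e1] at e2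
    omega

theorem closesUp_of_hCount_eq {p q : ℕ} {v : Torus n m}
    (h : hCount ω v (p * n + q * m) = p * n) : ClosesUp ω p q v := by
  refine ⟨?_, h⟩
  rw [quenchedWalk_iterate, h]
  simp

theorem ClosesUp.mem_periodicPts [NeZero n] {p q : ℕ} (hp : 0 < p) {v : Torus n m}
    (h : ClosesUp ω p q v) :
    v ∈ Function.periodicPts (quenchedWalk ω) :=
  ⟨p * n + q * m, by have := Nat.mul_pos hp (NeZero.pos n); omega, h.1⟩

theorem range_iterate_eq_of_mem {v w : Torus n m}
    (hv : v ∈ Function.periodicPts (quenchedWalk ω))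
    (hw : w ∈ Set.range fun k : ℕ => (quenchedWalk ω)^[k] v) :
    w ∈ Function.periodicPts (quenchedWalk ω) ∧
      (Set.range fun k : ℕ => (quenchedWalk ω)^[k] w) =
        Set.range fun k : ℕ => (quenchedWalk ω)^[k] v := by
  obtain ⟨k, rfl⟩ := hw
  obtain ⟨P, hP, h⟩ := hv
  refine ⟨⟨P, hP, ?_⟩, ?_⟩
  · change (quenchedWalk ω)^[P] _ = _
    simp only
    rw [← Function.iterate_add_apply, add_comm, Function.iterate_add_apply,
      show (quenchedWalk ω)^[P] v = v from h]
  · ext u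
    simp only [Set.mem_range]
    constructor
    · rintro ⟨i, rfl⟩
      exact ⟨i + k, by rw [Function.iterate_add_apply]⟩
    · rintro ⟨i, rfl⟩
      refine ⟨i + (k * P - k), ?_⟩
      have hk : k ≤ k * P := Nat.le_mul_of_pos_right k hP
      rw [← Function.iterate_add_apply, show i + (k * P - k) + k = i + k * P by omega,
        Function.iterate_add_apply, iterate_mul_of_closed h]

variable [NeZero n] [NeZero m]

theorem ncard_crossings {v : Torus n m} (hv : v ∈ Function.periodicPts (quenchedWalk ω))
    {p q : ℕ} (hP : Function.minimalPeriod (quenchedWalk ω) v = p * n + q * m)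
    (hh : hCount ω v (p * n + q * m) = p * n) :
    HasHomologyClass ω (Set.range fun k : ℕ => (quenchedWalk ω)^[k] v) p q := by
  constructor
  · intro i
    rw [ncard_orbit_sep ω hv (fun u => u.1 = i ∧ ω u = true), hP]
    have := count_and_count (fun t => ω ((quenchedWalk ω)^[t] v) = true)
      (fun s : ℕ => v.1 + (s : ZMod n) = i) (p * n + q * m)
    change _ = Nat.count _ (hCount ω v (p * n + q * m)) at this
    rw [hh, count_residue] at this
    refine Eq.trans ?_ this
    congr 1
    ext t
    rw [and_comm]
    nth_rewrite 2 [quenchedWalk_iterate]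
    rfl
  · intro j
    rw [ncard_orbit_sep ω hv (fun u => u.2 = j ∧ ω u = false), hP]
    have key : ∀ t, Nat.count (fun t => ¬ ω ((quenchedWalk ω)^[t] v) = true) t =
        t - hCount ω v t := by
      intro t
      have := count_not (fun t => ω ((quenchedWalk ω)^[t] v) = true) t
      unfold hCount
      omega
    have := count_and_count (fun t => ¬ ω ((quenchedWalk ω)^[t] v) = true)
      (fun s : ℕ => v.2 + (s : ZMod m) = j) (p * n + q * m)
    rw [key, hh, Nat.add_sub_cancel_left, count_residue] at this
    refine Eq.trans ?_ this
    congr 1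
    ext t
    rw [and_comm, key, Nat.cast_sub (hCount_le _ _ _)]
    nth_rewrite 2 [quenchedWalk_iterate]
    simp

/-- If the closed walk ran `j` times through a shorter one with winding numbers `(p', q')`, then `j`
would divide both `p` and `q`. -/
theorem ClosesUp.minimalPeriod_eq {p q : ℕ} (hpq : p.Coprime q) {v : Torus n m}
    (h : ClosesUp ω p q v) :
    Function.minimalPeriod (quenchedWalk ω) v = p * n + q * m := by
  obtain ⟨h1, h2⟩ := h
  have hper := Function.iterate_minimalPeriod (f := quenchedWalk ω) (x := v)
  obtain ⟨j, hj⟩ := Function.IsPeriodicPt.minimalPeriod_dvd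
    (show Function.IsPeriodicPt (quenchedWalk ω) _ v from h1)
  obtain ⟨p', q', hP, hh⟩ := exists_displacement hper
  have hm := hCount_mul hper j
  rw [mul_comm j, ← hj, h2, hh, ← mul_assoc] at hm
  have hp' : p = j * p' := Nat.eq_of_mul_eq_mul_right (NeZero.pos n) hm
  have hq' : q = j * q' := by
    apply Nat.eq_of_mul_eq_mul_right (NeZero.pos m)
    rw [hP] at hj
    have : (p' * n + q' * m) * j = j * p' * n + j * q' * m := by ring
    rw [this] at hj
    omega
  have hj1 : j = 1 := by
    have : j ∣ Nat.gcd p q := Nat.dvd_gcd ⟨_, hp'⟩ ⟨_, hq'⟩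
    rw [hpq] at this
    exact Nat.dvd_one.1 this
  subst hj1
  rw [mul_one] at hj
  exact hj.symm

theorem ClosesUp.hasHomologyClass {p q : ℕ} (hp : 0 < p) (hpq : p.Coprime q) {v : Torus n m}
    (h : ClosesUp ω p q v) :
    HasHomologyClass ω (Set.range fun k : ℕ => (quenchedWalk ω)^[k] v) p q :=
  ncard_crossings (h.mem_periodicPts hp) (h.minimalPeriod_eq hpq) h.2

theorem closesUp_of_hasHomologyClass {p q : ℕ} {v : Torus n m}
    (hv : v ∈ Function.periodicPts (quenchedWalk ω))
    (h : HasHomologyClass ω (Set.range fun k : ℕ => (quenchedWalk ω)^[k] v) p q) :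
    ClosesUp ω p q v := by
  have hper := Function.iterate_minimalPeriod (f := quenchedWalk ω) (x := v)
  obtain ⟨p', q', hP, hh⟩ := exists_displacement hper
  have h' := ncard_crossings hv hP (hP ▸ hh)
  have e1 : p' = p := (h'.1 0).symm.trans (h.1 0)
  have e2 : q' = q := (h'.2 0).symm.trans (h.2 0)
  subst e1 e2
  rw [hP] at hh hper
  exact ⟨hper, hh⟩

/-- Since `p > 0`, the cycle crosses out of column `0`. Only `m` starting points then have to be
considered in the union bound. -/
theorem exists_closesUp_of_hasHomologyClass {p q : ℕ} (hp : 0 < p) {S : Set (Torus n m)}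
    (hS : IsCycleOf ω S) (h : HasHomologyClass ω S p q) :
    ∃ y : ZMod m, ClosesUp ω p q (0, y) ∧
      S = Set.range fun k : ℕ => (quenchedWalk ω)^[k] (0, y) := by
  obtain ⟨v, hv, rfl⟩ := hS
  have h0 := h.1 0
  have : {u ∈ Set.range fun k : ℕ => (quenchedWalk ω)^[k] v | u.1 = 0 ∧ ω u = true}.Nonempty := by
    apply Set.nonempty_of_ncard_ne_zero
    omega
  obtain ⟨⟨x, y⟩, hu, hx, -⟩ := this
  simp only at hx
  subst hx
  obtain ⟨h1, h2⟩ := range_iterate_eq_of_mem hv hu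
  refine ⟨y, closesUp_of_hasHomologyClass h1 (h2 ▸ h), h2.symm⟩

end Closed

/-! ### Non-crossing, and one cycle forcing the class of all others -/

section Monotone

variable {n m : ℕ} {ω : EdgeChoice n m}

/-- The translate of `v` by `k` steps along its antidiagonal. -/
def antidiagShift (v : Torus n m) (k : ℤ) : Torus n m := (v.1 + k, v.2 - k)

@[simp] theorem antidiagShift_zero (v : Torus n m) : antidiagShift v 0 = v := by
  simp [antidiagShift]

theorem hCount_one (v : Torus n m) : hCount ω v 1 = if ω v = true then 1 else 0 := by
  rw [← zero_add 1, hCount_succ, hCount_zero, zero_add]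
  rfl

theorem iterate_antidiagShift (v : Torus n m) (k : ℤ) (t : ℕ) :
    (quenchedWalk ω)^[t] (antidiagShift v k) =
      antidiagShift ((quenchedWalk ω)^[t] v)
        (k + hCount ω (antidiagShift v k) t - hCount ω v t) := by
  rw [quenchedWalk_iterate, quenchedWalk_iterate]
  ext <;> simp only [antidiagShift] <;> push_cast <;> ring

/-- Two walks started on a common antidiagonal do not cross. -/
theorem hCount_le_add_hCount (v : Torus n m) {k : ℤ} (hk : 0 ≤ k) (t : ℕ) :
    (hCount ω v t : ℤ) ≤ k + hCount ω (antidiagShift v k) t := by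
  induction t with
  | zero => simpa using hk
  | succ t ih =>
    rw [hCount_succ, hCount_succ]
    -- The gap changes by at most one per step. If it is zero, both walks stand at the same vertex
    -- and take the same edge.
    rcases ih.lt_or_eq with h | h
    · push_cast; split_ifs <;> omega
    · have := iterate_antidiagShift (ω := ω) v k t
      rw [h, sub_self] at this
      rw [this, antidiagShift_zero]
      push_cast
      omega

theorem ClosesUp.hCount_mul {p q : ℕ} {v : Torus n m} (h : ClosesUp ω p q v) (j : ℕ) :
    hCount ω v (j * (p * n + q * m)) = j * (p * n) := by
  rw [_root_.hCount_mul h.1, h.2]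

theorem hCount_mono (v : Torus n m) : Monotone (hCount ω v) := Nat.count_monotone _

/-- Every lift of `w` lies on the antidiagonal that the walk from `v` reaches at the matching time.
The free windings `i` and `j` select the lift, so that `w` can be put on either side of the walk. -/
theorem exists_iterate_eq_antidiagShift [NeZero n] [NeZero m] (v w : Torus n m) :
    ∃ a b : ℕ, ∀ i j : ℕ, w =
      antidiagShift ((quenchedWalk ω)^[a + n * i + (b + m * j)] v)
        ((a + n * i : ℕ) - hCount ω v (a + n * i + (b + m * j)) : ℤ) := by
  obtain ⟨a, ha⟩ := ZMod.natCast_zmod_surjective (w.1 - v.1)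
  obtain ⟨b, hb⟩ := ZMod.natCast_zmod_surjective (w.2 - v.2)
  refine ⟨a, b, fun i j => ?_⟩
  rw [quenchedWalk_iterate]
  ext <;> simp only [antidiagShift] <;> push_cast
  · rw [ha, ZMod.natCast_self]; ring
  · rw [hb, ZMod.natCast_self m]; ring

variable [NeZero n] [NeZero m]

/-- Enough horizontal windings place a lift of `w` to the right of the closed walk, because that
walk spends a positive share of its time on vertical steps. Non-crossing then keeps it there. -/
theorem ClosesUp.exists_le {p q : ℕ} (hq : 0 < q) {v : Torus n m}
    (h : ClosesUp ω p q v) (w : Torus n m) :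
    ∃ k : ℕ, ∀ j : ℕ, (j * (p * n) : ℤ) ≤ k + hCount ω w (j * (p * n + q * m)) := by
  obtain ⟨a, b, hab⟩ := exists_iterate_eq_antidiagShift (ω := ω) v w
  set L := p * n + q * m with hL
  have hqm : 0 < q * m := Nat.mul_pos hq (NeZero.pos m)
  have hLpos : 0 < L := by omega
  -- `M` bounds the horizontal steps made in the remainder `a + b`. Taking `L * M` windings gains `n
  -- * (q * m) * M`, which is at least `M`.
  set M := ((a + b) / L + 1) * (p * n) with hM
  have hw := hab (L * M) 0
  set i := a + n * (L * M) + (b + m * 0) with hi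
  have hile : hCount ω v i ≤ n * M * (p * n) + M := by
    have e : i = (a + b) + (n * M) * L := by rw [hi]; ring
    have h1 : i ≤ ((a + b) / L + 1 + n * M) * L := by
      have := Nat.lt_div_mul_add hLpos (a := a + b)
      rw [e]; nlinarith
    calc hCount ω v i ≤ _ := hCount_mono v h1
      _ = n * M * (p * n) + M := by rw [h.hCount_mul, hM]; ring
  have hk : (0 : ℤ) ≤ (a + n * (L * M) : ℕ) - hCount ω v i := by
    have hn : 0 < n := NeZero.pos n
    have : n * M * (p * n) + M ≤ n * (L * M) := by
      have e : n * (L * M) = n * M * (p * n) + n * (q * m) * M := by rw [hL]; ring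
      have : 1 * M ≤ n * (q * m) * M := Nat.mul_le_mul_right _ (Nat.mul_pos hn hqm)
      omega
    omega
  obtain ⟨k, hk'⟩ := Int.eq_ofNat_of_zero_le hk
  refine ⟨k, fun j => ?_⟩
  have := hCount_le_add_hCount (ω := ω) ((quenchedWalk ω)^[i] v) hk (j * L)
  rw [← hw, hk', (h.iterate i).hCount_mul] at this
  push_cast at this
  exact this

/-- The mirror image of `ClosesUp.exists_le`: vertical windings place a lift of `w` to the left of
the closed walk. -/
theorem ClosesUp.exists_ge {p q : ℕ} (hp : 0 < p) {v : Torus n m}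
    (h : ClosesUp ω p q v) (w : Torus n m) :
    ∃ k : ℕ, ∀ j : ℕ, (hCount ω w (j * (p * n + q * m)) : ℤ) ≤ j * (p * n) + k := by
  obtain ⟨a, b, hab⟩ := exists_iterate_eq_antidiagShift (ω := ω) v w
  set L := p * n + q * m with hL
  have hpn : 0 < p * n := Nat.mul_pos hp (NeZero.pos n)
  have hw := hab 0 (L * a)
  set i := a + n * 0 + (b + m * (L * a)) with hi
  have hile : a ≤ hCount ω v i := by
    have h1 : a * L ≤ i := by
      have : 1 * (L * a) ≤ m * (L * a) := Nat.mul_le_mul_right _ (NeZero.pos m)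
      rw [hi]; nlinarith
    calc a ≤ a * (p * n) := Nat.le_mul_of_pos_right _ hpn
      _ = hCount ω v (a * L) := (h.hCount_mul a).symm
      _ ≤ _ := hCount_mono v h1
  obtain ⟨k, hk⟩ := Int.eq_ofNat_of_zero_le (show (0 : ℤ) ≤ hCount ω v i - a by omega)
  refine ⟨k, fun j => ?_⟩
  have hv : (quenchedWalk ω)^[i] v = antidiagShift w k := by
    rw [hw]
    rw [← hk]
    ext <;> simp only [antidiagShift] <;> push_cast <;> ring
  have := hCount_le_add_hCount (ω := ω) w (Int.natCast_nonneg k) (j * L)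
  rw [← hv, (h.iterate i).hCount_mul] at this
  push_cast at this
  linarith

theorem pos_or_neg_of_step (G : ℕ → ℤ) (h0 : ∀ t, G t ≠ 0)
    (h1 : ∀ t, |G (t + 1) - G t| ≤ 1) : (∀ t, 0 < G t) ∨ ∀ t, G t < 0 := by
  rcases (h0 0).lt_or_gt with h | h
  · right
    intro t
    induction t with
    | zero => exact h
    | succ t ih => have := h0 (t + 1); have := abs_le.1 (h1 t); omega
  · left
    intro t
    induction t with
    | zero => exact h
    | succ t ih => have := h0 (t + 1); have := abs_le.1 (h1 t); omega

/-- If some walk closes up after `(p, q)` turns, then so does every periodic walk. -/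
theorem ClosesUp.of_mem_periodicPts {p q : ℕ} (hp : 0 < p) (hq : 0 < q) {v : Torus n m}
    (h : ClosesUp ω p q v) {w : Torus n m} (hw : w ∈ Function.periodicPts (quenchedWalk ω)) :
    ClosesUp ω p q w := by
  set L := p * n + q * m with hL
  obtain ⟨k₁, h₁⟩ := h.exists_le hq w
  obtain ⟨k₂, h₂⟩ := h.exists_ge hp w
  obtain ⟨P, hP, hwP⟩ := hw
  -- `G t` is the excess of horizontal steps in the window of length `L` starting at time `t`.
  -- Sliding the window drops one step and adds one, so `G` moves by at most one; a zero of `G`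
  -- gives a closed walk on the orbit of `w`.
  set G : ℕ → ℤ := fun t => hCount ω ((quenchedWalk ω)^[t] w) L - (p * n : ℕ) with hG
  have hzero : ∀ t, G t = 0 → ClosesUp ω p q w := by
    intro t ht
    have hc : ClosesUp ω p q ((quenchedWalk ω)^[t] w) :=
      closesUp_of_hCount_eq (by simp only [hG] at ht; rw [← hL]; omega)
    have := hc.iterate (t * P - t)
    have htP : t ≤ t * P := Nat.le_mul_of_pos_right t hP
    rwa [← Function.iterate_add_apply, Nat.sub_add_cancel htP, iterate_mul_of_closed hwP] at this
  by_contra hcon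
  have hstep : ∀ t, |G (t + 1) - G t| ≤ 1 := by
    intro t
    have e1 := hCount_add ω ((quenchedWalk ω)^[t] w) 1 L
    have e2 := hCount_succ ω ((quenchedWalk ω)^[t] w) L
    have e3 := hCount_one (ω := ω) ((quenchedWalk ω)^[t] w)
    rw [← Function.iterate_add_apply, add_comm 1 L, add_comm 1 t, e2, e3] at e1
    rw [abs_le]
    simp only [hG]
    split_ifs at e1 <;> constructor <;> omega
  have hsum : ∀ j, hCount ω w ((j + 1) * L) =
      hCount ω w (j * L) + hCount ω ((quenchedWalk ω)^[j * L] w) L := by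
    intro j
    rw [add_mul, one_mul, hCount_add]
  -- If `G` never vanishes it keeps its sign, so each block of `L` steps adds a deviation of at
  -- least one, against the bounds `k₁` and `k₂`.
  rcases pos_or_neg_of_step G (fun t ht => hcon (hzero t ht)) hstep with hpos | hneg
  · have : ∀ j : ℕ, (j * (p * n) + j : ℤ) ≤ hCount ω w (j * L) := by
      intro j
      induction j with
      | zero => simp
      | succ j ih =>
        have := hpos (j * L)
        simp only [hG] at this
        rw [hsum]
        push_cast at this ⊢
        linarith
    have h3 := this (k₂ + 1)
    have h4 := h₂ (k₂ + 1)
    push_cast at h3 h4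
    linarith
  · have : ∀ j : ℕ, (hCount ω w (j * L) : ℤ) ≤ j * (p * n) - j := by
      intro j
      induction j with
      | zero => simp
      | succ j ih =>
        have := hneg (j * L)
        simp only [hG] at this
        rw [hsum]
        push_cast at this ⊢
        linarith
    have h3 := this (k₁ + 1)
    have h4 := h₁ (k₁ + 1)
    push_cast at h3 h4
    linarith

theorem ClosesUp.forall_hasHomologyClass {p q : ℕ} (hp : 0 < p) (hq : 0 < q) (hpq : p.Coprime q)
    {v : Torus n m} (h : ClosesUp ω p q v) {S : Set (Torus n m)} (hS : IsCycleOf ω S) :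
    HasHomologyClass ω S p q := by
  obtain ⟨w, hw, rfl⟩ := hS
  exact (h.of_mem_periodicPts hp hq hw).hasHomologyClass hp hpq

end Monotone

/-! ### Deterministic step sequences -/

/-- The number of horizontal steps among the first `t` steps of the step sequence `b`. -/
def onesCount {L : ℕ} (b : Fin L → Bool) (t : ℕ) : ℕ :=
  ∑ i : Fin L, if (i : ℕ) < t ∧ b i = true then 1 else 0

/-- The position after `t` steps of the path from `v` with step sequence `b`. -/
def latticePath {n m L : ℕ} (v : Torus n m) (b : Fin L → Bool) (t : ℕ) : Torus n m :=
  (v.1 + (onesCount b t : ZMod n), v.2 + ((t : ZMod m) - (onesCount b t : ZMod m)))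

/-- The walk from `v` follows the step sequence `b`. -/
def Follows {n m L : ℕ} (ω : EdgeChoice n m) (v : Torus n m) (b : Fin L → Bool) : Prop :=
  ∀ t : Fin L, ω (latticePath v b t) = b t

@[simp] theorem onesCount_zero {L : ℕ} (b : Fin L → Bool) : onesCount b 0 = 0 := by
  simp [onesCount]

theorem onesCount_succ {L : ℕ} (b : Fin L → Bool) {t : ℕ} (ht : t < L) :
    onesCount b (t + 1) = onesCount b t + if b ⟨t, ht⟩ = true then 1 else 0 := by
  have h : ∀ i : Fin L, (if (i : ℕ) < t + 1 ∧ b i = true then 1 else 0) =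
      (if (i : ℕ) < t ∧ b i = true then 1 else 0) +
        if i = ⟨t, ht⟩ then (if b ⟨t, ht⟩ = true then 1 else 0) else 0 := by
    intro i
    by_cases hi : i = ⟨t, ht⟩
    · subst hi; simp
    · have : (i : ℕ) ≠ t := fun h => hi (Fin.ext h)
      have : (i : ℕ) < t + 1 ↔ (i : ℕ) < t := by omega
      simp [hi, this]
  unfold onesCount
  rw [Finset.sum_congr rfl fun i _ => h i, Finset.sum_add_distrib]
  simp

section Follows

variable {n m L : ℕ} {ω : EdgeChoice n m} {v : Torus n m} {b : Fin L → Bool}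

theorem Follows.hCount_eq (h : Follows ω v b) {t : ℕ} (ht : t ≤ L) :
    hCount ω v t = onesCount b t := by
  induction t with
  | zero => simp
  | succ t ih =>
    have := h ⟨t, ht⟩
    rw [hCount_succ, onesCount_succ b ht, quenchedWalk_iterate, ih (by omega)]
    rw [latticePath] at this
    rw [this]

theorem Follows.iterate_eq (h : Follows ω v b) {t : ℕ} (ht : t ≤ L) :
    (quenchedWalk ω)^[t] v = latticePath v b t := by
  rw [quenchedWalk_iterate, h.hCount_eq ht, latticePath]

theorem Follows.eq_apply (h : Follows ω v b) : b = fun t : Fin L => ω ((quenchedWalk ω)^[t] v) := by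
  funext t
  rw [h.iterate_eq t.2.le, h t]

theorem follows_walk (ω : EdgeChoice n m) (v : Torus n m) (L : ℕ) :
    Follows ω v (fun t : Fin L => ω ((quenchedWalk ω)^[t] v)) := by
  have : ∀ t ≤ L, onesCount (fun t : Fin L => ω ((quenchedWalk ω)^[t] v)) t = hCount ω v t := by
    intro t
    induction t with
    | zero => simp
    | succ t ih =>
      intro ht
      rw [onesCount_succ _ ht, hCount_succ, ih (by omega)]
  intro t
  rw [latticePath, this t t.2.le, ← quenchedWalk_iterate]

end Follows

/-! ### Probability of following prescribed paths -/

section Law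

variable {n m : ℕ}

instance : IsProbabilityMeasure (quenchedLaw n m) := by
  unfold quenchedLaw; infer_instance

theorem quenchedLaw_cylinder {I : Type*} [Fintype I] {f : I → Torus n m}
    (hf : Function.Injective f) (b : I → Bool) :
    (quenchedLaw n m).real {ω | ∀ i, ω (f i) = b i} = (1 / 2 : ℝ) ^ Fintype.card I := by
  classical
  have hset : {ω : EdgeChoice n m | ∀ i, ω (f i) = b i} =
      Set.pi (Finset.univ.image f : Finset (Torus n m))
        fun v => {β | ∀ i, f i = v → β = b i} := by
    ext ω
    simp only [Set.mem_ofPred_eq, Set.mem_pi, Finset.coe_image, Finset.coe_univ, Set.image_univ,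
      Set.mem_range]
    constructor
    · rintro h _ - i rfl
      exact h i
    · intro h i
      exact h _ ⟨i, rfl⟩ i rfl
  rw [measureReal_def, quenchedLaw, hset,
    Measure.infinitePi_pi _ (fun _ _ => MeasurableSet.of_discrete),
    Finset.prod_image hf.injOn]
  have : ∀ i : I, {β : Bool | ∀ j, f j = f i → β = b j} = {b i} := by
    intro i
    ext β
    simp only [Set.mem_ofPred_eq, Set.mem_singleton_iff]
    exact ⟨fun h => h i rfl, fun h j hj => by rw [h, hf hj]⟩
  simp_rw [this, PMF.toMeasure_apply_singleton _ _ (MeasurableSet.of_discrete),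
    PMF.uniformOfFintype_apply]
  simp

variable {L : ℕ} {J : Type*} [Fintype J]

/-- When the paths visit pairwise distinct vertices, each choice of step sequences prescribes
`Fintype.card J * L` independent coins. The rest is a union bound. -/
theorem quenchedLaw_follows_le (v : J → Torus n m) (G : J → Finset (Fin L → Bool)) :
    (quenchedLaw n m).real {ω | (∀ s, ∃ b ∈ G s, Follows ω (v s) b) ∧
        Function.Injective fun x : J × Fin L => (quenchedWalk ω)^[x.2] (v x.1)} ≤
      ∏ s, ((G s).card : ℝ) / 2 ^ L := by
  classical
  set F := (Fintype.piFinset G).filter fun b =>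
    Function.Injective fun x : J × Fin L => latticePath (v x.1) (b x.1) x.2 with hF
  have hsub : {ω | (∀ s, ∃ b ∈ G s, Follows ω (v s) b) ∧
      Function.Injective fun x : J × Fin L => (quenchedWalk ω)^[x.2] (v x.1)} ⊆
      ⋃ b ∈ F, {ω : EdgeChoice n m |
        ∀ x : J × Fin L, ω (latticePath (v x.1) (b x.1) x.2) = b x.1 x.2} := by
    rintro ω ⟨h, hinj⟩
    choose b hb hfol using h
    simp only [Set.mem_iUnion, hF, Finset.mem_filter, Fintype.mem_piFinset]
    refine ⟨b, ⟨hb, ?_⟩, fun x => hfol x.1 x.2⟩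
    intro x y hxy
    apply hinj
    simpa only [(hfol _).iterate_eq (Fin.is_lt _).le] using hxy
  calc _ ≤ _ := measureReal_mono hsub (measure_ne_top _ _)
    _ ≤ ∑ b ∈ F, (quenchedLaw n m).real _ := measureReal_biUnion_finset_le _ _
    _ = ∑ b ∈ F, (1 / 2 : ℝ) ^ (Fintype.card J * L) := by
      refine Finset.sum_congr rfl fun b hb => ?_
      rw [quenchedLaw_cylinder (Finset.mem_filter.1 hb).2 (fun x => b x.1 x.2)]
      simp
    _ ≤ ∑ b ∈ Fintype.piFinset G, (1 / 2 : ℝ) ^ (Fintype.card J * L) :=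
      Finset.sum_le_sum_of_subset_of_nonneg (Finset.filter_subset _ _) fun _ _ _ => by positivity
    _ = _ := by
      rw [Finset.sum_const, Fintype.card_piFinset, Finset.prod_div_distrib, Finset.prod_const,
        nsmul_eq_mul, Finset.card_univ, ← pow_mul, mul_comm L, one_div, inv_pow, div_eq_mul_inv]
      push_cast
      rfl

/-- Disjointness now holds for all admissible sequences, and the configuration determines the
sequence it follows. The union is therefore disjoint and the bound becomes an equality. -/
theorem quenchedLaw_follows_eq [NeZero n] [NeZero m] (v : J → Torus n m)
    (G : J → Finset (Fin L → Bool))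
    (hG : ∀ b : J → Fin L → Bool, (∀ s, b s ∈ G s) →
      Function.Injective fun x : J × Fin L => latticePath (v x.1) (b x.1) x.2) :
    (quenchedLaw n m).real {ω | ∀ s, ∃ b ∈ G s, Follows ω (v s) b} =
      ∏ s, ((G s).card : ℝ) / 2 ^ L := by
  classical
  have hset : {ω : EdgeChoice n m | ∀ s, ∃ b ∈ G s, Follows ω (v s) b} =
      ⋃ b ∈ Fintype.piFinset G, {ω : EdgeChoice n m |
        ∀ x : J × Fin L, ω (latticePath (v x.1) (b x.1) x.2) = b x.1 x.2} := by
    ext ω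
    simp only [Set.mem_ofPred_eq, Set.mem_iUnion, Fintype.mem_piFinset, exists_prop]
    constructor
    · intro h
      choose b hb hfol using h
      exact ⟨b, hb, fun x => hfol x.1 x.2⟩
    · rintro ⟨b, hb, hfol⟩ s
      exact ⟨b s, hb s, fun t => hfol (s, t)⟩
  rw [hset, measureReal_biUnion_finset]
  · calc _ = ∑ b ∈ Fintype.piFinset G, (1 / 2 : ℝ) ^ (Fintype.card J * L) := by
          refine Finset.sum_congr rfl fun b hb => ?_
          rw [quenchedLaw_cylinder (hG b (Fintype.mem_piFinset.1 hb)) (fun x => b x.1 x.2)]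
          simp
      _ = _ := by
        rw [Finset.sum_const, Fintype.card_piFinset, Finset.prod_div_distrib, Finset.prod_const,
          nsmul_eq_mul, Finset.card_univ, ← pow_mul, mul_comm L, one_div, inv_pow, div_eq_mul_inv]
        push_cast
        rfl
  · intro b _ b' _ hne
    rw [Function.onFun, Set.disjoint_left]
    intro ω h h'
    apply hne
    funext s
    have e1 : Follows ω (v s) (b s) := fun t => h (s, t)
    have e2 : Follows ω (v s) (b' s) := fun t => h' (s, t)
    exact e1.eq_apply.trans e2.eq_apply.symm
  · exact fun _ _ => MeasurableSet.of_discrete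

end Law

theorem card_filter_onesCount (L h : ℕ) :
    (Finset.univ.filter fun b : Fin L → Bool => onesCount b L = h).card = L.choose h := by
  classical
  have hc : L.choose h = ((Finset.univ : Finset (Fin L)).powersetCard h).card := by simp
  rw [hc]
  refine Finset.card_bij' (fun b _ => Finset.univ.filter fun i => b i = true)
    (fun s _ i => decide (i ∈ s)) ?_ ?_ ?_ ?_
  · intro b hb
    simpa [onesCount, Finset.mem_powersetCard] using hb
  · intro s hs
    simpa [onesCount, Finset.mem_powersetCard] using hs
  · intro b _
    simp
  · intro s _
    simp

/-! ### Union bound for the number of cycles -/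

section Upper

variable {n m : ℕ} [NeZero n] [NeZero m]

/-- Two orbits sharing a vertex are the same cycle, and within one cycle the first `L` vertices are
distinct because `L` is the minimal period. -/
theorem exists_starting_points {p q : ℕ} (hp : 0 < p) (hpq : p.Coprime q) {ω : EdgeChoice n m}
    {k : ℕ} (hk : k ≤ numCycles p q ω) :
    ∃ Y : Finset (ZMod m), Y.card = k ∧ (∀ y ∈ Y, ClosesUp ω p q (0, y)) ∧
      Function.Injective fun x : Y × Fin (p * n + q * m) =>
        (quenchedWalk ω)^[x.2] ((0 : ZMod n), (x.1 : ZMod m)) := by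
  classical
  obtain ⟨T, hT, hcard⟩ := Set.exists_subset_card_eq hk
  have hex : ∀ S : T, ∃ y : ZMod m, ClosesUp ω p q (0, y) ∧
      (S : Set (Torus n m)) = Set.range fun k : ℕ => (quenchedWalk ω)^[k] (0, y) :=
    fun S => exists_closesUp_of_hasHomologyClass hp (hT S.2).1 (hT S.2).2
  choose y hy hrange using hex
  have hinj : Function.Injective y := fun S S' h => Subtype.ext (by rw [hrange S, hrange S', h])
  refine ⟨Finset.univ.image y, ?_, ?_, ?_⟩
  · rw [Finset.card_image_of_injective _ hinj, Finset.card_univ, ← Nat.card_eq_fintype_card]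
    exact hcard
  · intro z hz
    obtain ⟨S, -, rfl⟩ := Finset.mem_image.1 hz
    exact hy S
  · rintro ⟨⟨z, hz⟩, t⟩ ⟨⟨z', hz'⟩, t'⟩ h
    obtain ⟨S, -, rfl⟩ := Finset.mem_image.1 hz
    obtain ⟨S', -, rfl⟩ := Finset.mem_image.1 hz'
    simp only at h
    have e1 := (range_iterate_eq_of_mem ((hy S).mem_periodicPts hp) ⟨t, rfl⟩).2
    have e2 := (range_iterate_eq_of_mem ((hy S').mem_periodicPts hp) ⟨t', rfl⟩).2
    simp only at e1 e2
    rw [← hrange] at e1 e2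
    have hSS : S = S' := Subtype.ext (by rw [← e1, ← e2, h])
    subst hSS
    have := (hy S).minimalPeriod_eq hpq
    have htt := (Function.iterate_eq_iterate_iff_of_lt_minimalPeriod (by rw [this]; exact t.2)
      (by rw [this]; exact t'.2)).1 h
    rw [Fin.ext htt]

theorem quenchedLaw_le_numCycles {p q : ℕ} (hp : 0 < p) (hpq : p.Coprime q) (k : ℕ) :
    (quenchedLaw n m).real {ω | k ≤ numCycles p q ω} ≤
      m.choose k * (((p * n + q * m).choose (p * n) : ℝ) / 2 ^ (p * n + q * m)) ^ k := by
  classical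
  set L := p * n + q * m with hL
  set G := Finset.univ.filter fun b : Fin L → Bool => onesCount b L = p * n
  have hsub : {ω : EdgeChoice n m | k ≤ numCycles p q ω} ⊆
      ⋃ Y ∈ Finset.powersetCard k (Finset.univ : Finset (ZMod m)),
        {ω | (∀ s : Y, ∃ b ∈ G, Follows ω ((0 : ZMod n), (s : ZMod m)) b) ∧
          Function.Injective fun x : Y × Fin L =>
            (quenchedWalk ω)^[x.2] ((0 : ZMod n), (x.1 : ZMod m))} := by
    intro ω hω
    obtain ⟨Y, hY, hc, hinj⟩ := exists_starting_points hp hpq hω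
    simp only [Set.mem_iUnion, Finset.mem_powersetCard]
    refine ⟨Y, ⟨Finset.subset_univ _, hY⟩, fun s => ?_, hinj⟩
    have hf := follows_walk ω ((0 : ZMod n), (s : ZMod m)) L
    refine ⟨_, ?_, hf⟩
    simp only [G, Finset.mem_filter, Finset.mem_univ, true_and]
    rw [← hf.hCount_eq le_rfl]
    exact (hc s s.2).2
  calc _ ≤ _ := measureReal_mono hsub (measure_ne_top _ _)
    _ ≤ ∑ Y ∈ Finset.powersetCard k (Finset.univ : Finset (ZMod m)), (quenchedLaw n m).real _ :=
      measureReal_biUnion_finset_le _ _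
    _ ≤ ∑ Y ∈ Finset.powersetCard k (Finset.univ : Finset (ZMod m)),
        ((L.choose (p * n) : ℝ) / 2 ^ L) ^ k := by
      refine Finset.sum_le_sum fun Y hY => ?_
      refine (quenchedLaw_follows_le (fun s : Y => ((0 : ZMod n), (s : ZMod m)))
        fun _ => G).trans_eq ?_
      rw [Finset.prod_const, Finset.card_univ, Fintype.card_coe, (Finset.mem_powersetCard.1 hY).2,
        card_filter_onesCount]
    _ = _ := by
      rw [Finset.sum_const, Finset.card_powersetCard, Finset.card_univ, ZMod.card, nsmul_eq_mul]

end Upper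

/-! ### Binomial estimates and the upper tail -/

theorem centralBinom_sq_mul_le (n : ℕ) : n.centralBinom ^ 2 * (2 * n + 1) ≤ 16 ^ n := by
  induction n with
  | zero => simp
  | succ n ih =>
    have h := Nat.succ_mul_centralBinom_succ n
    have h2 : (n + 1) ^ 2 * ((n + 1).centralBinom ^ 2 * (2 * (n + 1) + 1)) ≤
        (n + 1) ^ 2 * 16 ^ (n + 1) := by
      calc (n + 1) ^ 2 * ((n + 1).centralBinom ^ 2 * (2 * (n + 1) + 1))
          = ((n + 1) * (n + 1).centralBinom) ^ 2 * (2 * n + 3) := by ring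
        _ = 4 * ((2 * n + 1) * (2 * n + 3)) * (n.centralBinom ^ 2 * (2 * n + 1)) := by
          rw [h]; ring
        _ ≤ 4 * (4 * (n + 1) ^ 2) * 16 ^ n :=
          Nat.mul_le_mul (Nat.mul_le_mul_left 4 (by nlinarith)) ih
        _ = _ := by ring
    exact Nat.le_of_mul_le_mul_left h2 (by positivity)

theorem choose_le_two_pow_div_sqrt (L h : ℕ) (hL : 0 < L) :
    (L.choose h : ℝ) / 2 ^ L ≤ 2 / √(L : ℝ) := by
  have key : ∀ n h : ℕ, ((2 * n).choose h : ℝ) ≤ 4 ^ n / √(2 * n + 1 : ℝ) := by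
    intro n h
    have h1 : ((2 * n).choose h : ℝ) ≤ n.centralBinom := by
      exact_mod_cast Nat.choose_le_centralBinom h n
    refine h1.trans ?_
    rw [le_div_iff₀ (by positivity)]
    apply le_of_sq_le_sq _ (by positivity)
    rw [mul_pow, Real.sq_sqrt (by positivity), ← pow_mul, mul_comm n, pow_mul]
    norm_num
    exact_mod_cast centralBinom_sq_mul_le n
  have hL' : (0 : ℝ) < L := by exact_mod_cast hL
  rw [div_le_div_iff₀ (by positivity) (by positivity)]
  -- Even `L` is bounded by the central coefficient; odd `L` reduces to it by Pascal's rule, which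
  -- costs the factor `2`.
  rcases Nat.even_or_odd' L with ⟨n, rfl | rfl⟩
  · have h1 := key n h
    rw [le_div_iff₀ (by positivity)] at h1
    calc _ ≤ ((2 * n).choose h : ℝ) * √(2 * n + 1 : ℝ) := by
          gcongr; push_cast; linarith
      _ ≤ 4 ^ n := h1
      _ ≤ 2 * 2 ^ (2 * n) := by
        rw [pow_mul]; norm_num
  · have h2 : ((2 * n + 1).choose h : ℝ) * √(2 * n + 1 : ℝ) ≤ 2 * 4 ^ n := by
      cases h with
      | zero =>
        have h1 := key n 0
        rw [le_div_iff₀ (by positivity)] at h1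
        simp only [Nat.choose_zero_right] at h1 ⊢
        linarith [show (0 : ℝ) < 4 ^ n by positivity]
      | succ h =>
        have h1 := key n h
        have h3 := key n (h + 1)
        rw [le_div_iff₀ (by positivity)] at h1 h3
        rw [Nat.choose_succ_succ]
        push_cast
        nlinarith
    push_cast
    calc _ ≤ _ := h2
      _ ≤ _ := by
        rw [pow_succ, pow_mul]; norm_num

/-- A single term of the series of `exp (e² x)` is at most its sum, which is at most `exp k`;
dividing by `exp (2 * k)` gives the bound. -/
theorem pow_div_factorial_le (x : ℝ) (hx : 0 ≤ x) (k : ℕ) (h : Real.exp 2 * x ≤ k) :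
    x ^ k / k.factorial ≤ Real.exp (-k) := by
  have h1 := Real.pow_div_factorial_le_exp (Real.exp 2 * x) (by positivity) k
  rw [mul_pow, mul_div_assoc, ← Real.exp_nat_mul] at h1
  have h2 : Real.exp (k * 2) * (x ^ k / k.factorial) ≤ Real.exp k :=
    h1.trans (Real.exp_le_exp.2 h)
  have h3 : Real.exp k = Real.exp (k * 2) * Real.exp (-k) := by
    rw [← Real.exp_add]; ring_nf
  rw [h3] at h2
  exact le_of_mul_le_mul_left h2 (Real.exp_pos _)

/-- The upper tail of the number of cycles. -/
theorem quenchedLaw_numCycles_gt_le {p q : ℕ} (hp : 0 < p) (hpq : p.Coprime q)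
    {n m : ℕ} [NeZero n] [NeZero m] {M C : ℝ} (hM : (m : ℝ) ≤ M * n)
    (hC : 2 * Real.exp 2 * M ≤ C) (hC1 : 1 ≤ C) :
    (quenchedLaw n m).real {ω | C * √(n : ℝ) < (numCycles p q ω : ℝ)} ≤
      Real.exp (-(C⁻¹ * √(n : ℝ))) := by
  set k := ⌊C * √(n : ℝ)⌋₊ + 1 with hk
  set L := p * n + q * m with hL
  have hn : 0 < n := NeZero.pos n
  have hnL : n ≤ L := (Nat.le_mul_of_pos_left n hp).trans (Nat.le_add_right _ _)
  have hk1 : C * √(n : ℝ) ≤ k := by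
    rw [hk]; push_cast; exact (Nat.lt_floor_add_one _).le
  have hsub : {ω : EdgeChoice n m | C * √(n : ℝ) < (numCycles p q ω : ℝ)} ⊆
      {ω | k ≤ numCycles p q ω} := by
    intro ω hω
    exact (Nat.floor_lt (by positivity)).2 hω
  have hsq : (0 : ℝ) < √(n : ℝ) := Real.sqrt_pos.2 (by exact_mod_cast hn)
  have hnn : (n : ℝ) = √(n : ℝ) * √(n : ℝ) := (Real.mul_self_sqrt (by positivity)).symm
  have hM0 : 0 ≤ M := by
    by_contra hneg
    push Not at hneg
    have : (0 : ℝ) < n := by exact_mod_cast hn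
    have : (0 : ℝ) ≤ m := by positivity
    nlinarith
  have hβ : (m : ℝ) * ((L.choose (p * n) : ℝ) / 2 ^ L) ≤ 2 * M * √(n : ℝ) := by
    have h1 : (L.choose (p * n) : ℝ) / 2 ^ L ≤ 2 / √(n : ℝ) := by
      refine (choose_le_two_pow_div_sqrt L (p * n) (hn.trans_le hnL)).trans ?_
      gcongr
    calc (m : ℝ) * ((L.choose (p * n) : ℝ) / 2 ^ L) ≤ (M * n) * (2 / √(n : ℝ)) := by gcongr
      _ = _ := by
        rw [mul_div_assoc', div_eq_iff hsq.ne']; nth_rewrite 1 [hnn]; ring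
  calc _ ≤ _ := measureReal_mono hsub (measure_ne_top _ _)
    _ ≤ m.choose k * ((L.choose (p * n) : ℝ) / 2 ^ L) ^ k := quenchedLaw_le_numCycles hp hpq k
    _ ≤ ((m : ℝ) ^ k / k.factorial) * ((L.choose (p * n) : ℝ) / 2 ^ L) ^ k := by
      gcongr
      exact Nat.choose_le_pow_div k m
    _ = ((m : ℝ) * ((L.choose (p * n) : ℝ) / 2 ^ L)) ^ k / k.factorial := by
      rw [mul_pow]; ring
    _ ≤ (2 * M * √(n : ℝ)) ^ k / k.factorial := by gcongr
    _ ≤ Real.exp (-k) := by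
      apply pow_div_factorial_le _ (by positivity)
      refine le_trans ?_ hk1
      calc _ = 2 * Real.exp 2 * M * √(n : ℝ) := by ring
        _ ≤ _ := by gcongr
    _ ≤ _ := by
      apply Real.exp_le_exp.2
      have : C⁻¹ ≤ C := (inv_le_one_of_one_le₀ hC1).trans hC1
      have : C⁻¹ * √(n : ℝ) ≤ C * √(n : ℝ) := by gcongr
      linarith

/-! ### Tilted coins and the probability of staying in a tube -/

/-- The probability of the step sequence `b` when every step is horizontal with probability `r`. -/
noncomputable def stepWeight {L : ℕ} (r : ℝ) (b : Fin L → Bool) : ℝ :=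
  ∏ i, if b i = true then r else 1 - r

/-- The step sequence `b`, started from `y` and recentered by the drift `r`, leaves `[-R, R]`. -/
def Exits {L : ℕ} (r R y : ℝ) (b : Fin L → Bool) : Prop :=
  ∃ t ≤ L, R < |y + onesCount b t - r * t|

theorem sum_fin_succ_bool {L : ℕ} (f : (Fin (L + 1) → Bool) → ℝ) :
    ∑ b, f b = ∑ b : Fin L → Bool, f (Fin.cons true b) +
      ∑ b : Fin L → Bool, f (Fin.cons false b) := by
  rw [← (Fin.consEquiv fun _ : Fin (L + 1) => Bool).sum_comp, Fintype.sum_prod_type,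
    Fintype.sum_bool]
  rfl

theorem stepWeight_cons {L : ℕ} (r : ℝ) (a : Bool) (b : Fin L → Bool) :
    stepWeight r (Fin.cons a b : Fin (L + 1) → Bool) =
      (if a = true then r else 1 - r) * stepWeight r b := by
  simp [stepWeight, Fin.prod_univ_succ]

theorem stepWeight_nonneg {L : ℕ} {r : ℝ} (h0 : 0 ≤ r) (h1 : r ≤ 1) (b : Fin L → Bool) :
    0 ≤ stepWeight r b :=
  Finset.prod_nonneg fun i _ => by split_ifs <;> linarith

theorem sum_stepWeight (L : ℕ) (r : ℝ) : ∑ b : Fin L → Bool, stepWeight r b = 1 := by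
  induction L with
  | zero => simp [stepWeight]
  | succ L ih =>
    rw [sum_fin_succ_bool]
    simp only [stepWeight_cons, ← Finset.mul_sum, ih]
    simp

theorem onesCount_cons_succ {L : ℕ} (a : Bool) (b : Fin L → Bool) (t : ℕ) :
    onesCount (Fin.cons a b : Fin (L + 1) → Bool) (t + 1) =
      (if a = true then 1 else 0) + onesCount b t := by
  unfold onesCount
  rw [Fin.sum_univ_succ]
  simp

theorem exits_cons {L : ℕ} {r R y : ℝ} (hy : |y| ≤ R) (a : Bool) (b : Fin L → Bool) :
    Exits r R y (Fin.cons a b : Fin (L + 1) → Bool) ↔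
      Exits r R (y + (if a = true then 1 else 0) - r) b := by
  constructor
  · rintro ⟨t, ht, h⟩
    cases t with
    | zero => simp at h; linarith
    | succ t =>
      refine ⟨t, by omega, ?_⟩
      rw [onesCount_cons_succ] at h
      convert h using 2
      push_cast
      ring
  · rintro ⟨t, ht, h⟩
    refine ⟨t + 1, by omega, ?_⟩
    rw [onesCount_cons_succ]
    convert h using 2
    push_cast
    ring

open Classical in
/-- Kolmogorov's maximal inequality for Bernoulli steps. -/
theorem sum_exits_le {r R : ℝ} (h0 : 0 ≤ r) (h1 : r ≤ 1) (hR : 0 < R) (L : ℕ) (y : ℝ) :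
    ∑ b : Fin L → Bool, (if Exits r R y b then stepWeight r b else 0) ≤
      (y ^ 2 + L / 4) / R ^ 2 := by
  have htriv : ∀ (L : ℕ) (y : ℝ), R < |y| →
      ∑ b : Fin L → Bool, (if Exits r R y b then stepWeight r b else 0) ≤
        (y ^ 2 + L / 4) / R ^ 2 := by
    intro L y hy
    have hy2 : R ^ 2 ≤ y ^ 2 := by
      rw [← sq_abs y]; gcongr
    calc _ ≤ ∑ b : Fin L → Bool, stepWeight r b := by
          refine Finset.sum_le_sum fun b _ => ?_
          split_ifs
          · exact le_rfl
          · exact stepWeight_nonneg h0 h1 b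
      _ = 1 := sum_stepWeight L r
      _ ≤ _ := by
        rw [le_div_iff₀ (by positivity)]
        have : (0 : ℝ) ≤ L / 4 := by positivity
        linarith
  induction L generalizing y with
  | zero =>
    by_cases hy : R < |y|
    · exact htriv 0 y hy
    · have : ∀ b : Fin 0 → Bool, ¬ Exits r R y b := by
        rintro b ⟨t, ht, h⟩
        obtain rfl : t = 0 := by omega
        simp at h
        exact hy h
      simp only [this, if_false, Finset.sum_const_zero]
      positivity
  | succ L ih =>
    by_cases hy : R < |y|
    · exact htriv _ y hy
    · push Not at hy
      rw [sum_fin_succ_bool]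
      simp only [exits_cons hy, stepWeight_cons, if_true, Bool.false_eq_true, if_false,
        ← mul_ite_zero, ← Finset.mul_sum]
      -- Conditioning on the first step, `y ^ 2` grows on average by the variance `r * (1 - r)`,
      -- which is at most `1 / 4`.
      have e1 := mul_le_mul_of_nonneg_left (ih (y + 1 - r)) h0
      have e2 := mul_le_mul_of_nonneg_left (ih (y + 0 - r)) (sub_nonneg.2 h1)
      refine (add_le_add e1 e2).trans ?_
      rw [← mul_div_assoc, ← mul_div_assoc, ← add_div]
      refine div_le_div_of_nonneg_right ?_ (by positivity)
      push_cast
      nlinarith [sq_nonneg (r - 1 / 2)]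

/-- With `θ = 2 * r - 1` the factors are `(1 ± θ) / 2`, at most `exp (± θ) / 2`. This is the density
of the tilted coin against the fair one. -/
theorem stepWeight_le {L : ℕ} {r : ℝ} (h0 : 0 ≤ r) (h1 : r ≤ 1) (b : Fin L → Bool) :
    stepWeight r b ≤ Real.exp ((2 * r - 1) * (2 * onesCount b L - L)) / 2 ^ L := by
  have e : ∀ i : Fin L, (if b i = true then r else 1 - r) ≤
      Real.exp ((2 * r - 1) * (2 * (if b i = true then 1 else 0) - 1)) / 2 := by
    intro i
    split_ifs
    · rw [le_div_iff₀ two_pos]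
      refine le_trans (le_of_eq ?_) (Real.add_one_le_exp _)
      ring
    · rw [le_div_iff₀ two_pos]
      refine le_trans (le_of_eq ?_) (Real.add_one_le_exp _)
      ring
  calc stepWeight r b
      ≤ ∏ i : Fin L, Real.exp ((2 * r - 1) * (2 * (if b i = true then 1 else 0) - 1)) / 2 :=
        Finset.prod_le_prod (fun i _ => by split_ifs <;> linarith) fun i _ => e i
    _ = _ := by
      rw [Finset.prod_div_distrib, ← Real.exp_sum, ← Finset.mul_sum, Finset.sum_sub_distrib,
        ← Finset.mul_sum]
      simp [onesCount]

open Classical in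
/-- The step sequences that follow a line of slope `r` within distance `R`. -/
noncomputable def tube (L : ℕ) (r R : ℝ) : Finset (Fin L → Bool) :=
  Finset.univ.filter fun b => ∀ t ≤ L, |(onesCount b t : ℝ) - r * t| ≤ R

theorem mem_tube {L : ℕ} {r R : ℝ} {b : Fin L → Bool} :
    b ∈ tube L r R ↔ ∀ t ≤ L, |(onesCount b t : ℝ) - r * t| ≤ R := by
  simp [tube]

/-- Under the tilted coin the tube has weight at least `1 - L / (4 * R ^ 2)` by the maximal
inequality. On the tube the final count is within `R` of `r * L`, so the density against the fair
coin is at most the exponential of the stated cost. -/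
theorem tube_card_ge {L : ℕ} {r R : ℝ} (h0 : 0 ≤ r) (h1 : r ≤ 1) (hR : 0 < R) :
    (1 - L / (4 * R ^ 2)) * Real.exp (-(|2 * r - 1| * (|2 * r - 1| * L + 2 * R))) ≤
      (tube L r R).card / 2 ^ L := by
  classical
  set E := |2 * r - 1| * (|2 * r - 1| * L + 2 * R) with hE
  have hex : ∀ b : Fin L → Bool, ¬ Exits r R 0 b ↔ b ∈ tube L r R := by
    intro b
    simp [mem_tube, Exits]
  have hw : ∀ b ∈ tube L r R, stepWeight r b ≤ Real.exp E / 2 ^ L := by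
    intro b hb
    refine (stepWeight_le h0 h1 b).trans ?_
    gcongr
    have hb' := mem_tube.1 hb L le_rfl
    calc _ ≤ |(2 * r - 1) * (2 * onesCount b L - L)| := le_abs_self _
      _ = |2 * r - 1| * |(2 * r - 1) * L + 2 * (onesCount b L - r * L)| := by
        rw [abs_mul]; congr 2; ring
      _ ≤ _ := by
        rw [hE]
        gcongr
        refine (abs_add_le _ _).trans ?_
        rw [abs_mul, abs_mul, Nat.abs_cast, abs_two]
        gcongr
  have hsum : 1 - L / (4 * R ^ 2) ≤ ∑ b ∈ tube L r R, stepWeight r b := by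
    have h2 := sum_exits_le h0 h1 hR L 0
    have h3 := sum_stepWeight L r
    rw [← Finset.sum_filter_add_sum_filter_not _ (fun b => Exits r R 0 b), Finset.sum_filter] at h3
    have h4 : (Finset.univ.filter fun b : Fin L → Bool => ¬ Exits r R 0 b) = tube L r R := by
      ext b; simp [hex]
    rw [h4] at h3
    have h5 : ((0 : ℝ) ^ 2 + L / 4) / R ^ 2 = L / (4 * R ^ 2) := by
      rw [zero_pow two_ne_zero, zero_add, div_div]
    linarith
  have h6 : ∑ b ∈ tube L r R, stepWeight r b ≤ (tube L r R).card * (Real.exp E / 2 ^ L) := by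
    rw [← nsmul_eq_mul]
    exact Finset.sum_le_card_nsmul _ _ _ hw
  rw [Real.exp_neg, ← div_eq_mul_inv, div_le_iff₀ (Real.exp_pos _)]
  calc _ ≤ _ := hsum.trans h6
    _ = _ := by ring

/-! ### Lifts to the plane and transverse distance to the geodesic -/

/-- The image in the torus of the lattice point `(x, t - x)`. -/
def gridPoint (n m : ℕ) (t : ℕ) (x : ℤ) : Torus n m := (x, (t : ZMod m) - x)

section Geometry

variable {n m : ℕ}

theorem latticePath_gridPoint {L : ℕ} (u : ℤ) (b : Fin L → Bool) (t : ℕ) :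
    latticePath (gridPoint n m 0 u) b t = gridPoint n m t (u + onesCount b t) := by
  ext <;> simp only [latticePath, gridPoint] <;> push_cast <;> ring

theorem iterate_gridPoint (ω : EdgeChoice n m) (u : ℤ) (t : ℕ) :
    (quenchedWalk ω)^[t] (gridPoint n m 0 u) =
      gridPoint n m t (u + hCount ω (gridPoint n m 0 u) t) := by
  rw [quenchedWalk_iterate]
  ext <;> simp only [gridPoint] <;> push_cast <;> ring

theorem antidiagShift_gridPoint (t : ℕ) (u k : ℤ) :
    antidiagShift (gridPoint n m t u) k = gridPoint n m t (u + k) := by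
  ext <;> simp only [antidiagShift, gridPoint] <;> push_cast <;> ring

theorem add_hCount_le_add_hCount (ω : EdgeChoice n m) {u u' : ℤ} (h : u ≤ u') (t : ℕ) :
    u + hCount ω (gridPoint n m 0 u) t ≤ u' + hCount ω (gridPoint n m 0 u') t := by
  have := hCount_le_add_hCount (ω := ω) (gridPoint n m 0 u) (sub_nonneg.2 h) t
  rw [antidiagShift_gridPoint, add_sub_cancel] at this
  linarith

/-- The slope in the `x` coordinate of the geodesic of homology class `(p, q)`. -/
noncomputable def geodesicSlope (p q n m : ℕ) : ℝ := (p * n : ℕ) / (p * n + q * m : ℕ)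

/-- Lifts of one vertex differ by a translation `(n * α, m * β)`, which changes the transverse
coordinate by `n * m / L` times the integer `β * p - α * q`. If that integer vanishes, coprimality
gives `(α, β) = k • (p, q)`; the times then differ by `k * L`, so `k = 0`. -/
theorem gridPoint_inj {p q : ℕ} (hp : 0 < p) (hpq : p.Coprime q) [NeZero n] [NeZero m]
    {t t' : ℕ} (ht : t < p * n + q * m) (ht' : t' < p * n + q * m) {x x' : ℤ}
    (h : gridPoint n m t x = gridPoint n m t' x')
    (hx : |(x - geodesicSlope p q n m * t) - (x' - geodesicSlope p q n m * t')| <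
      (n * m : ℝ) / (p * n + q * m : ℕ)) : t = t' ∧ x = x' := by
  have h1 : (x : ZMod n) = x' := congrArg Prod.fst h
  have h2 : ((t - x : ℤ) : ZMod m) = ((t' - x' : ℤ) : ZMod m) := by
    push_cast; exact congrArg Prod.snd h
  rw [ZMod.intCast_eq_intCast_iff_dvd_sub] at h1 h2
  obtain ⟨α, hα⟩ := h1
  obtain ⟨β, hβ⟩ := h2
  set L := p * n + q * m with hL
  have hn : (0 : ℝ) < n := by exact_mod_cast NeZero.pos n
  have hm : (0 : ℝ) < m := by exact_mod_cast NeZero.pos m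
  have hLpos : (0 : ℝ) < (L : ℕ) := by exact_mod_cast (Nat.zero_le _).trans_lt ht
  have hLr : ((L : ℕ) : ℝ) = p * n + q * m := by rw [hL]; push_cast; ring
  have hαr : (x' : ℝ) - x = n * α := by exact_mod_cast hα
  have hβr : ((t' : ℝ) - x') - (t - x) = m * β := by exact_mod_cast hβ
  have key : (x - geodesicSlope p q n m * t) - (x' - geodesicSlope p q n m * t') =
      (n * m : ℝ) / (L : ℕ) * (((β * p - α * q : ℤ)) : ℝ) := by
    rw [geodesicSlope, ← hL]
    field_simp
    rw [hLr]
    push_cast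
    have e1 : (x : ℝ) = x' - n * α := by linarith
    have e2 : (t : ℝ) = t' - n * α - m * β := by linarith
    rw [e1, e2]
    ring
  have hpos : (0 : ℝ) < (n * m : ℝ) / (L : ℕ) := by positivity
  rw [key, abs_mul, abs_of_pos hpos] at hx
  have h3 : |((β * p - α * q : ℤ) : ℝ)| < 1 := by
    by_contra hcon
    push Not at hcon
    nlinarith
  have h4 : β * p - α * q = 0 := by
    have : |β * p - α * q| < 1 := by exact_mod_cast h3
    exact Int.abs_lt_one_iff.1 this
  have hdvd : (p : ℤ) ∣ α := by
    have : (p : ℤ) ∣ α * q := ⟨β, by linarith⟩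
    exact (Int.isCoprime_iff_gcd_eq_one.2 (by simpa using hpq)).dvd_of_dvd_mul_right this
  obtain ⟨k, rfl⟩ := hdvd
  have hβk : β = q * k := by
    have hp' : (p : ℤ) ≠ 0 := by exact_mod_cast hp.ne'
    apply mul_right_cancel₀ hp'
    linarith
  subst hβk
  have htk : (t' : ℤ) - t = k * (L : ℕ) := by
    rw [hL]; push_cast; linarith
  have hk : k = 0 := by
    by_contra hne
    rcases lt_or_gt_of_ne hne with hlt | hgt
    · have : k * ((L : ℕ) : ℤ) ≤ (-1) * (L : ℕ) :=
        mul_le_mul_of_nonneg_right (by omega) (by positivity)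
      omega
    · have : 1 * ((L : ℕ) : ℤ) ≤ k * (L : ℕ) :=
        mul_le_mul_of_nonneg_right (by omega) (by positivity)
      omega
  subst hk
  simp at hα htk
  omega

/-- A discrete intermediate value theorem. The displacement `hCount - p * n` may jump up, but by
monotonicity it drops by at most one when `u` increases by one, so the last `u` with nonnegative
displacement has displacement zero. -/
theorem exists_closesUp_between {p q : ℕ} {ω : EdgeChoice n m} {c₁ c₂ : ℤ} (hc : c₁ ≤ c₂)
    (h₁ : p * n ≤ hCount ω (gridPoint n m 0 c₁) (p * n + q * m))
    (h₂ : hCount ω (gridPoint n m 0 c₂) (p * n + q * m) ≤ p * n) :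
    ∃ u, c₁ ≤ u ∧ u ≤ c₂ ∧ ClosesUp ω p q (gridPoint n m 0 u) := by
  obtain ⟨u, ⟨hu, huc, hu'⟩, hmax⟩ := Int.exists_greatest_of_bdd
    (P := fun u => c₁ ≤ u ∧ u ≤ c₂ ∧ p * n ≤ hCount ω (gridPoint n m 0 u) (p * n + q * m))
    ⟨c₂, fun z hz => hz.2.1⟩ ⟨c₁, le_rfl, hc, h₁⟩
  refine ⟨u, hu, huc, closesUp_of_hCount_eq ?_⟩
  rcases huc.eq_or_lt with rfl | hlt
  · omega
  · have h3 : ¬ p * n ≤ hCount ω (gridPoint n m 0 (u + 1)) (p * n + q * m) := fun h => by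
      have := hmax (u + 1) ⟨by omega, by omega, h⟩
      omega
    have := add_hCount_le_add_hCount ω (show u ≤ u + 1 by omega) (p * n + q * m)
    omega

end Geometry

/-! ### Chernoff bound for independent events -/

open Classical in
/-- A lower tail bound for the number of successes among independent events. -/
theorem card_events_le_exp {Ω : Type*} [MeasurableSpace Ω] {μ : Measure Ω} [IsProbabilityMeasure μ]
    {K : ℕ} {E : Fin K → Set Ω} (hE : ∀ j, MeasurableSet (E j))
    (hind : ProbabilityTheory.iIndepSet E μ)
    {ε : ℝ} (hε : ∀ j, ε ≤ μ.real (E j)) (x : ℝ) :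
    μ.real {ω | ((Finset.univ.filter fun j => ω ∈ E j).card : ℝ) ≤ x} ≤
      Real.exp (x - ε * K / 2) := by
  set X : Fin K → Ω → ℝ := fun j => (E j).indicator fun _ => 1 with hX
  have hXm : ∀ j, Measurable (X j) := fun j => measurable_const.indicator (hE j)
  have hindX : ProbabilityTheory.iIndepFun X μ := hind.iIndepFun_indicator
  have hsum : ∀ ω, (∑ j, X j) ω = ((Finset.univ.filter fun j => ω ∈ E j).card : ℝ) := by
    intro ω
    rw [Finset.sum_apply, Finset.card_filter]
    push_cast
    rfl
  have hexp : ∀ j ω, Real.exp (-1 * X j ω) =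
      1 - (1 - Real.exp (-1)) * (E j).indicator (fun _ => (1 : ℝ)) ω := by
    intro j ω
    by_cases h : ω ∈ E j <;> simp [hX, h]
  -- The exponent `-1` suffices: `1 - exp (-1) ≥ 1 / 2`, so each factor is at most `1 - ε / 2`.
  have hmgf : ∀ j, ProbabilityTheory.mgf (X j) μ (-1) ≤ Real.exp (-(ε / 2)) := by
    intro j
    have hi : Integrable ((E j).indicator fun _ => (1 : ℝ)) μ :=
      (integrable_const 1).indicator (hE j)
    have h1 : ProbabilityTheory.mgf (X j) μ (-1) = 1 - (1 - Real.exp (-1)) * μ.real (E j) := by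
      rw [ProbabilityTheory.mgf]
      simp_rw [hexp]
      rw [integral_sub (integrable_const _) (hi.const_mul _), integral_const_mul,
        integral_indicator_const _ (hE j)]
      simp
    have h2 : Real.exp (-1) ≤ 1 / 2 := by
      rw [Real.exp_neg, one_div]
      have := Real.add_one_le_exp 1
      apply inv_anti₀ two_pos
      linarith
    have h3 := Real.add_one_le_exp (-(ε / 2))
    have h4 : 1 / 2 * μ.real (E j) ≤ (1 - Real.exp (-1)) * μ.real (E j) :=
      mul_le_mul_of_nonneg_right (by linarith) measureReal_nonneg
    rw [h1]
    linarith [hε j]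
  have hint : Integrable (fun ω => Real.exp (-1 * (∑ j, X j) ω)) μ := by
    have hm : Measurable fun ω => Real.exp (-1 * (∑ j, X j) ω) := by
      simp only [Finset.sum_apply]
      fun_prop
    refine Integrable.of_bound hm.aestronglyMeasurable 1 (ae_of_all _ fun ω => ?_)
    rw [Real.norm_eq_abs, abs_of_pos (Real.exp_pos _), Real.exp_le_one_iff, hsum]
    have : (0 : ℝ) ≤ ((Finset.univ.filter fun j => ω ∈ E j).card : ℝ) := by positivity
    linarith
  have hch := ProbabilityTheory.measure_le_le_exp_mul_mgf x (by norm_num : (-1 : ℝ) ≤ 0) hint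
  simp_rw [hsum] at hch
  refine hch.trans ?_
  rw [hindX.mgf_sum hXm]
  calc _ ≤ Real.exp (- -1 * x) * ∏ _j : Fin K, Real.exp (-(ε / 2)) := by
        gcongr with j
        · exact fun j _ => ProbabilityTheory.mgf_nonneg
        · exact hmgf j
    _ = _ := by
      rw [Finset.prod_const, Finset.card_univ, Fintype.card_fin, ← Real.exp_nat_mul, ← Real.exp_add]
      ring_nf

/-! ### Blocks of two converging tracks -/

/-- The slope of a track drifting away from the geodesic, to the right if `s` is true and to the
left otherwise, by one diffusive unit. -/
noncomputable def trackSlope (p q n m : ℕ) (s : Bool) : ℝ :=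
  geodesicSlope p q n m + (if s = true then 1 else -1) / √((p * n + q * m : ℕ) : ℝ)

/-- The step sequences that stay in a track. -/
noncomputable def trackSteps (p q n m : ℕ) (s : Bool) : Finset (Fin (p * n + q * m) → Bool) :=
  tube (p * n + q * m) (trackSlope p q n m s) (√((p * n + q * m : ℕ) : ℝ))

/-- The number of the track which has the direction `s` in the block `j`. -/
def trackIndex (j : ℕ) (s : Bool) : ℕ := 2 * j + if s = true then 0 else 1

/-- The walks from the centers of the two tracks of the block `j` stay in their tracks. -/
def blockEvent (p q n m w j : ℕ) : Set (EdgeChoice n m) :=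
  {ω | ∀ s, ∃ b ∈ trackSteps p q n m s,
    Follows ω (gridPoint n m 0 ((trackIndex j s * w : ℕ) : ℤ)) b}

theorem trackIndex_inj {j j' : ℕ} {s s' : Bool} (h : trackIndex j s = trackIndex j' s') :
    j = j' ∧ s = s' := by
  cases s <;> cases s' <;> simp [trackIndex] at h ⊢ <;> omega

theorem trackIndex_lt {j K : ℕ} (hj : j < K) (s : Bool) : trackIndex j s < 2 * K := by
  cases s <;> simp [trackIndex] <;> omega

section Blocks

variable {p q n m w K : ℕ}

/-- The tube radius and the total drift over `L` steps each contribute at most `√L`. -/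
theorem abs_onesCount_sub_le {s : Bool} {b : Fin (p * n + q * m) → Bool}
    (hb : b ∈ trackSteps p q n m s) {t : ℕ} (ht : t ≤ p * n + q * m) :
    |(onesCount b t : ℝ) - geodesicSlope p q n m * t| ≤ 2 * √((p * n + q * m : ℕ) : ℝ) := by
  have h := mem_tube.1 hb t ht
  set L := p * n + q * m
  have hd : (t : ℝ) / √(L : ℝ) ≤ √(L : ℝ) := by
    calc (t : ℝ) / √(L : ℝ) ≤ L / √(L : ℝ) := by gcongr
      _ = _ := Real.div_sqrt
  have hd0 : 0 ≤ (t : ℝ) / √(L : ℝ) := by positivity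
  have e : trackSlope p q n m s * t = geodesicSlope p q n m * t +
      (if s = true then 1 else -1) * (t / √(L : ℝ)) := by
    rw [trackSlope]; ring
  rw [e, abs_le] at h
  rw [abs_le]
  split_ifs at h <;> constructor <;> linarith [h.1, h.2]

/-- The track separation `w` and the number of blocks `K` are such that the blocks embed in the
torus. -/
structure BlocksFit (p q n m w K : ℕ) : Prop where
  lt_width : 4 * √((p * n + q * m : ℕ) : ℝ) < w
  total_le : 2 * K * w ≤ (n * m : ℝ) / (p * n + q * m : ℕ)

theorem BlocksFit.abs_sub_lt (h : BlocksFit p q n m w K) {i i' : ℕ} (hi : i < 2 * K)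
    (hi' : i' < 2 * K) :
    |((i * w : ℕ) : ℝ) - (i' * w : ℕ)| + 4 * √((p * n + q * m : ℕ) : ℝ) <
      (n * m : ℝ) / (p * n + q * m : ℕ) := by
  have h1 : |(i : ℝ) - i'| ≤ 2 * K - 1 := by
    have a1 : (i : ℝ) + 1 ≤ 2 * K := by exact_mod_cast hi
    have a2 : (i' : ℝ) + 1 ≤ 2 * K := by exact_mod_cast hi'
    rw [abs_le]
    constructor <;> linarith [Nat.cast_nonneg (α := ℝ) i, Nat.cast_nonneg (α := ℝ) i']
  have h2 : |((i * w : ℕ) : ℝ) - (i' * w : ℕ)| = |(i : ℝ) - i'| * w := by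
    push_cast
    rw [← sub_mul, abs_mul, Nat.abs_cast]
  have h3 : |(i : ℝ) - i'| * w ≤ (2 * K - 1) * w := by gcongr
  rw [h2]
  linarith [h.lt_width, h.total_le]

theorem le_abs_mul_sub_mul {i i' : ℕ} (hne : i ≠ i') (w : ℕ) :
    (w : ℝ) ≤ |((i * w : ℕ) : ℝ) - (i' * w : ℕ)| := by
  have h1 : (1 : ℝ) ≤ |(i : ℝ) - i'| := by
    have : (1 : ℤ) ≤ |(i : ℤ) - i'| := Int.one_le_abs (by omega)
    exact_mod_cast this
  push_cast
  rw [← sub_mul, abs_mul, Nat.abs_cast]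
  exact le_mul_of_one_le_left (by positivity) h1

theorem geodesicSlope_mul_length [NeZero n] (hp : 0 < p) :
    geodesicSlope p q n m * ((p * n + q * m : ℕ) : ℝ) = (p * n : ℕ) := by
  have : 0 < p * n := Nat.mul_pos hp (NeZero.pos n)
  have : ((p * n + q * m : ℕ) : ℝ) ≠ 0 := by
    have : p * n + q * m ≠ 0 := by omega
    exact_mod_cast this
  rw [geodesicSlope]
  field_simp

/-- After `L` steps the drift amounts to exactly one tube radius, so the endpoint is on the required
side of the geodesic. This supplies the signs needed by `exists_closesUp_between`. -/
theorem trackSteps_endpoint [NeZero n] (hp : 0 < p) {s : Bool} {b : Fin (p * n + q * m) → Bool}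
    (hb : b ∈ trackSteps p q n m s) :
    if s = true then p * n ≤ onesCount b (p * n + q * m)
    else onesCount b (p * n + q * m) ≤ p * n := by
  have h := abs_le.1 (mem_tube.1 hb _ le_rfl)
  have e : trackSlope p q n m s * ((p * n + q * m : ℕ) : ℝ) = (p * n : ℕ) +
      (if s = true then 1 else -1) * √((p * n + q * m : ℕ) : ℝ) := by
    rw [trackSlope, add_mul, geodesicSlope_mul_length hp, div_mul_eq_mul_div,
      mul_div_assoc, Real.div_sqrt]
  rw [e] at h
  split_ifs at h ⊢ with hs
  · have : ((p * n : ℕ) : ℝ) ≤ onesCount b (p * n + q * m) := by linarith [h.1]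
    exact_mod_cast this
  · have : (onesCount b (p * n + q * m) : ℝ) ≤ (p * n : ℕ) := by linarith [h.2]
    exact_mod_cast this

/-- In a block whose two tracks are followed there is a walk that closes up. -/
theorem exists_closesUp_of_mem_blockEvent [NeZero n] (hp : 0 < p) {j : ℕ} {ω : EdgeChoice n m}
    (h : ω ∈ blockEvent p q n m w j) :
    ∃ u : ℤ, ClosesUp ω p q (gridPoint n m 0 u) ∧ ∀ t ≤ p * n + q * m,
      ((2 * j * w : ℕ) : ℝ) - 2 * √((p * n + q * m : ℕ) : ℝ) ≤
        (u + hCount ω (gridPoint n m 0 u) t : ℝ) - geodesicSlope p q n m * t ∧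
      (u + hCount ω (gridPoint n m 0 u) t : ℝ) - geodesicSlope p q n m * t ≤
        (((2 * j + 1) * w : ℕ) : ℝ) + 2 * √((p * n + q * m : ℕ) : ℝ) := by
  obtain ⟨b₁, hb₁, hf₁⟩ := h true
  obtain ⟨b₂, hb₂, hf₂⟩ := h false
  have e₁ := trackSteps_endpoint hp hb₁
  have e₂ := trackSteps_endpoint hp hb₂
  simp only [trackIndex, if_true, Bool.false_eq_true, if_false, add_zero] at hf₁ hf₂ e₁ e₂
  rw [← hf₁.hCount_eq le_rfl] at e₁
  rw [← hf₂.hCount_eq le_rfl] at e₂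
  obtain ⟨u, hu₁, hu₂, hu⟩ := exists_closesUp_between (by push_cast; nlinarith) e₁ e₂
  refine ⟨u, hu, fun t ht => ?_⟩
  have s₁ := add_hCount_le_add_hCount ω hu₁ t
  have s₂ := add_hCount_le_add_hCount ω hu₂ t
  rw [hf₁.hCount_eq ht] at s₁
  rw [hf₂.hCount_eq ht] at s₂
  have d₁ := abs_le.1 (abs_onesCount_sub_le hb₁ ht)
  have d₂ := abs_le.1 (abs_onesCount_sub_le hb₂ ht)
  have s₁' : ((2 * j * w : ℕ) : ℝ) + onesCount b₁ t ≤ u + hCount ω (gridPoint n m 0 u) t := by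
    exact_mod_cast s₁
  have s₂' : (u : ℝ) + hCount ω (gridPoint n m 0 u) t ≤
      (((2 * j + 1) * w : ℕ) : ℝ) + onesCount b₂ t := by
    exact_mod_cast s₂
  constructor <;> linarith [d₁.1, d₁.2, d₂.1, d₂.2]

variable [NeZero n] [NeZero m]

/-- Each path stays within `2 * √L` of its geodesic. All transverse coordinates differ by less than
`n * m / L`, so `gridPoint_inj` excludes meetings through windings, and centers more than `4 * √L`
apart exclude direct ones. -/
theorem BlocksFit.latticePath_injective (h : BlocksFit p q n m w K) (hp : 0 < p)
    (hpq : p.Coprime q) {J : Type*} {idx : J → ℕ} (hidx : Function.Injective idx)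
    (hlt : ∀ s, idx s < 2 * K) {σ : J → Bool} {b : J → Fin (p * n + q * m) → Bool}
    (hb : ∀ s, b s ∈ trackSteps p q n m (σ s)) :
    Function.Injective fun x : J × Fin (p * n + q * m) =>
      latticePath (gridPoint n m 0 ((idx x.1 * w : ℕ) : ℤ)) (b x.1) x.2 := by
  rintro ⟨s, t⟩ ⟨s', t'⟩ heq
  simp only [latticePath_gridPoint] at heq
  have d1 := abs_le.1 (abs_onesCount_sub_le (hb s) t.2.le)
  have d2 := abs_le.1 (abs_onesCount_sub_le (hb s') t'.2.le)
  obtain ⟨e1, e2⟩ := gridPoint_inj hp hpq t.2 t'.2 heq (by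
    have h1 := h.abs_sub_lt (hlt s) (hlt s')
    refine lt_of_le_of_lt ?_ h1
    have e : ∀ a a' x x' y y' : ℝ, a + x - y - (a' + x' - y') = (a - a') + ((x - y) - (x' - y')) :=
      fun _ _ _ _ _ _ => by ring
    push_cast
    rw [e]
    refine (abs_add_le _ _).trans ?_
    gcongr
    rw [abs_le]
    constructor <;> push_cast at d1 d2 ⊢ <;> linarith [d1.1, d1.2, d2.1, d2.2])
  have ht : t = t' := Fin.ext e1
  subst ht
  by_cases hs : s = s'
  · rw [hs]
  · exfalso
    have h1 := le_abs_mul_sub_mul (fun h => hs (hidx h)) w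
    have h2 := h.lt_width
    have e3 : ((idx s * w : ℕ) : ℝ) + onesCount (b s) t = (idx s' * w : ℕ) + onesCount (b s') t := by
      exact_mod_cast e2
    have h3 : |((idx s * w : ℕ) : ℝ) - (idx s' * w : ℕ)| ≤ 4 * √((p * n + q * m : ℕ) : ℝ) := by
      rw [abs_le]
      constructor <;> linarith [d1.1, d1.2, d2.1, d2.2]
    linarith

/-- The probability that a walk stays in each of the two tracks of a block. -/
noncomputable def blockProb (p q n m : ℕ) : ℝ :=
  ∏ s, ((trackSteps p q n m s).card : ℝ) / 2 ^ (p * n + q * m)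

theorem BlocksFit.real_biInter_blockEvent (h : BlocksFit p q n m w K) (hp : 0 < p)
    (hpq : p.Coprime q) (T : Finset (Fin K)) :
    (quenchedLaw n m).real (⋂ j ∈ T, blockEvent p q n m w j) = blockProb p q n m ^ T.card := by
  have hset : (⋂ j ∈ T, blockEvent p q n m w j) =
      {ω | ∀ s : T × Bool, ∃ b ∈ trackSteps p q n m s.2,
        Follows ω (gridPoint n m 0 ((trackIndex s.1 s.2 * w : ℕ) : ℤ)) b} := by
    ext ω
    simp only [blockEvent, Set.mem_iInter, Set.mem_ofPred_eq, Prod.forall, Subtype.forall]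
  rw [hset, quenchedLaw_follows_eq
    (fun s : T × Bool => gridPoint n m 0 ((trackIndex s.1 s.2 * w : ℕ) : ℤ))
    (fun s => trackSteps p q n m s.2)]
  · rw [Fintype.prod_prod_type]
    simp only [blockProb, Finset.prod_const, Finset.card_univ, Fintype.card_coe]
  · intro b hb
    refine h.latticePath_injective hp hpq (idx := fun s : T × Bool => trackIndex s.1 s.2)
      (fun s s' hs => ?_) (fun s => trackIndex_lt s.1.1.2 s.2) hb
    obtain ⟨h1, h2⟩ := trackIndex_inj hs
    exact Prod.ext (Subtype.ext (Fin.ext h1)) h2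

theorem BlocksFit.real_blockEvent (h : BlocksFit p q n m w K) (hp : 0 < p)
    (hpq : p.Coprime q) (j : Fin K) :
    (quenchedLaw n m).real (blockEvent p q n m w j) = blockProb p q n m := by
  simpa using h.real_biInter_blockEvent hp hpq {j}

theorem BlocksFit.iIndepSet_blockEvent (h : BlocksFit p q n m w K) (hp : 0 < p)
    (hpq : p.Coprime q) :
    ProbabilityTheory.iIndepSet (fun j : Fin K => blockEvent p q n m w j) (quenchedLaw n m) := by
  rw [ProbabilityTheory.iIndepSet_iff_meas_biInter fun _ => MeasurableSet.of_discrete]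
  intro T
  have h1 := h.real_biInter_blockEvent hp hpq T
  have h2 : ∏ j ∈ T, (quenchedLaw n m).real (blockEvent p q n m w j) =
      blockProb p q n m ^ T.card := by
    rw [Finset.prod_congr rfl fun j _ => h.real_blockEvent hp hpq j, Finset.prod_const]
  rw [← ofReal_measureReal, h1, ← h2, ENNReal.ofReal_prod_of_nonneg fun _ _ => measureReal_nonneg]
  exact Finset.prod_congr rfl fun j _ => ofReal_measureReal

-- The trapped walks stay in strips that reach `2 * √L` beyond the track centers. Strips of
-- different blocks are disjoint since `w > 4 * √L`, and they do not meet around the torus either,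
-- so different blocks yield different cycles.
open Classical in
theorem BlocksFit.card_le_numCycles (h : BlocksFit p q n m w K) (hp : 0 < p)
    (hpq : p.Coprime q) (ω : EdgeChoice n m) :
    (Finset.univ.filter fun j : Fin K => ω ∈ blockEvent p q n m w j).card ≤ numCycles p q ω := by
  have hex : ∀ j : Fin K, ω ∈ blockEvent p q n m w j → _ :=
    fun j hj => exists_closesUp_of_mem_blockEvent hp hj
  choose! u hu hbd using hex
  set F : Fin K → Set (Torus n m) := fun j =>
    Set.range fun k : ℕ => (quenchedWalk ω)^[k] (gridPoint n m 0 (u j))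
  set T := Finset.univ.filter fun j : Fin K => ω ∈ blockEvent p q n m w j with hT
  have hmem : ∀ j ∈ T, ω ∈ blockEvent p q n m w j := fun j hj => (Finset.mem_filter.1 hj).2
  have hsub : F '' (T : Set (Fin K)) ⊆ {S | IsCycleOf ω S ∧ HasHomologyClass ω S p q} := by
    rintro _ ⟨j, hj, rfl⟩
    have := hu j (hmem j hj)
    exact ⟨⟨_, this.mem_periodicPts hp, rfl⟩, this.hasHomologyClass hp hpq⟩
  have hinj : Set.InjOn F T := by
    intro i hi j hj hij
    have hLpos : 0 < p * n + q * m := by have := Nat.mul_pos hp (NeZero.pos n); omega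
    have hui := hu i (hmem i hi)
    have hmj : gridPoint n m 0 (u j) ∈ F i := by
      rw [hij]; exact ⟨0, rfl⟩
    obtain ⟨k, hk⟩ := hmj
    simp only at hk
    set t := k % (p * n + q * m) with ht
    have htL : t < p * n + q * m := Nat.mod_lt _ hLpos
    have hkt : (quenchedWalk ω)^[t] (gridPoint n m 0 (u i)) = gridPoint n m 0 (u j) := by
      rw [← hk, ht, ← hui.minimalPeriod_eq hpq, Function.iterate_mod_minimalPeriod_eq]
    rw [iterate_gridPoint] at hkt
    have b1 := hbd i (hmem i hi) t htL.le
    have b2 := hbd j (hmem j hj) 0 (Nat.zero_le _)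
    simp only [hCount_zero, Nat.cast_zero, add_zero, mul_zero, sub_zero] at b2
    have hsp : ∀ i j : Fin K, |((((2 * (i : ℕ) + 1) * w : ℕ) : ℝ)) - (2 * (j : ℕ) * w : ℕ)| +
        4 * √((p * n + q * m : ℕ) : ℝ) < (n * m : ℝ) / (p * n + q * m : ℕ) :=
      fun i j => h.abs_sub_lt (by have := i.2; omega) (by have := j.2; omega)
    obtain ⟨h0, hx⟩ := gridPoint_inj hp hpq htL hLpos hkt (by
      have c1 := hsp i j
      have c2 := hsp j i
      have c3 := le_abs_self ((((2 * (i : ℕ) + 1) * w : ℕ) : ℝ) - (2 * (j : ℕ) * w : ℕ))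
      have c4 := le_abs_self ((((2 * (j : ℕ) + 1) * w : ℕ) : ℝ) - (2 * (i : ℕ) * w : ℕ))
      push_cast at b1 b2 c1 c2 c3 c4 ⊢
      rw [abs_lt]
      constructor <;> linarith [b1.1, b1.2, b2.1, b2.2])
    rw [h0] at b1 hx
    simp only [hCount_zero, Nat.cast_zero, add_zero, mul_zero, sub_zero] at b1 hx
    rw [hx] at b1
    by_contra hne
    have hw := h.lt_width
    rcases lt_or_gt_of_ne (fun h => hne (Fin.ext h) : (i : ℕ) ≠ j) with hlt | hlt
    · have : (2 * (i : ℕ) + 1) * w + w ≤ 2 * (j : ℕ) * w := by nlinarith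
      have : (((2 * (i : ℕ) + 1) * w : ℕ) : ℝ) + w ≤ (2 * (j : ℕ) * w : ℕ) := by exact_mod_cast this
      linarith [b1.1, b1.2, b2.1, b2.2]
    · have : (2 * (j : ℕ) + 1) * w + w ≤ 2 * (i : ℕ) * w := by nlinarith
      have : (((2 * (j : ℕ) + 1) * w : ℕ) : ℝ) + w ≤ (2 * (i : ℕ) * w : ℕ) := by exact_mod_cast this
      linarith [b1.1, b1.2, b2.1, b2.2]
  calc T.card = (F '' (T : Set (Fin K))).ncard := by
        rw [hinj.ncard_image, Set.ncard_coe_finset]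
    _ ≤ _ := Set.ncard_le_ncard hsub (Set.toFinite _)

end Blocks

/-! ### Uniform constants and the lower tail -/

section Parameters

variable {p q n m : ℕ} {D : ℝ}

theorem abs_two_mul_trackSlope_sub_one_mul_le (hp : 0 < p) (hn : 0 < n) (hD : 0 ≤ D)
    (hm : |(q * m : ℝ) - p * n| ≤ D * √(n : ℝ)) (s : Bool) :
    |2 * trackSlope p q n m s - 1| * √((p * n + q * m : ℕ) : ℝ) ≤ D + 2 := by
  set L := p * n + q * m with hL
  have hnL : n ≤ L := (Nat.le_mul_of_pos_left n hp).trans (Nat.le_add_right _ _)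
  have hLpos : (0 : ℝ) < L := by exact_mod_cast hn.trans_le hnL
  have hLr : (L : ℝ) = p * n + q * m := by rw [hL]; push_cast; ring
  have hs : 0 < √(L : ℝ) := Real.sqrt_pos.2 hLpos
  have hss : √(L : ℝ) * √(L : ℝ) = L := Real.mul_self_sqrt hLpos.le
  have hsn : √(n : ℝ) ≤ √(L : ℝ) := Real.sqrt_le_sqrt (by exact_mod_cast hnL)
  -- The geodesic slope differs from `1 / 2` by `(p * n - q * m) / (2 * L)`, of order `1 / √L`, like
  -- the drift.
  have e : (2 * trackSlope p q n m s - 1) * √(L : ℝ) =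
      -((q * m : ℝ) - p * n) / √(L : ℝ) + 2 * (if s = true then 1 else -1) := by
    rw [trackSlope, geodesicSlope, ← hL]
    have : (2 * (((p * n : ℕ) : ℝ) / L) - 1) * √(L : ℝ) = -((q * m : ℝ) - p * n) / √(L : ℝ) := by
      rw [eq_div_iff hs.ne', mul_assoc, hss]
      push_cast
      field_simp
      rw [hLr]
      ring
    rw [← this]
    field_simp
    ring
  have e' : |2 * trackSlope p q n m s - 1| * √(L : ℝ) =
      |(2 * trackSlope p q n m s - 1) * √(L : ℝ)| := by rw [abs_mul, abs_of_pos hs]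
  rw [e', e]
  refine (abs_add_le _ _).trans ?_
  have h1 : |-((q * m : ℝ) - p * n) / √(L : ℝ)| ≤ D := by
    rw [abs_div, abs_neg, abs_of_pos hs, div_le_iff₀ hs]
    exact hm.trans (by gcongr)
  have h2 : |(2 : ℝ) * (if s = true then 1 else -1)| = 2 := by
    split_ifs <;> simp
  rw [h2]
  linarith

theorem le_trackSteps_card (hp : 0 < p) (hn : 0 < n) (hD : 0 ≤ D)
    (hm : |(q * m : ℝ) - p * n| ≤ D * √(n : ℝ)) (hlarge : D + 2 ≤ √(n : ℝ)) (s : Bool) :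
    3 / 4 * Real.exp (-((D + 2) * (D + 4))) ≤
      ((trackSteps p q n m s).card : ℝ) / 2 ^ (p * n + q * m) := by
  have hθ := abs_two_mul_trackSlope_sub_one_mul_le hp hn hD hm s
  set L := p * n + q * m with hL
  have hnL : n ≤ L := (Nat.le_mul_of_pos_left n hp).trans (Nat.le_add_right _ _)
  have hLpos : (0 : ℝ) < L := by exact_mod_cast hn.trans_le hnL
  have hs : 0 < √(L : ℝ) := Real.sqrt_pos.2 hLpos
  have hss : √(L : ℝ) * √(L : ℝ) = L := Real.mul_self_sqrt hLpos.le
  have hsn : √(n : ℝ) ≤ √(L : ℝ) := Real.sqrt_le_sqrt (by exact_mod_cast hnL)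
  set θ := |2 * trackSlope p q n m s - 1| with hθdef
  have hθ0 : 0 ≤ θ := abs_nonneg _
  have hθ1 : θ ≤ 1 := by
    by_contra hcon
    push Not at hcon
    nlinarith
  have hr := abs_le.1 hθ1
  refine le_trans ?_ (tube_card_ge (L := L) (r := trackSlope p q n m s) (by linarith [hr.1])
    (by linarith [hr.2]) hs)
  rw [Real.sq_sqrt hLpos.le, ← hθdef]
  have e1 : (1 : ℝ) - L / (4 * L) = 3 / 4 := by field_simp; norm_num
  have e2 : θ * (θ * L + 2 * √(L : ℝ)) ≤ (D + 2) * (D + 4) := by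
    have : θ * (θ * L + 2 * √(L : ℝ)) = (θ * √(L : ℝ)) * (θ * √(L : ℝ) + 2) := by
      nth_rewrite 1 [← hss]; ring
    rw [this]
    have h0 : 0 ≤ θ * √(L : ℝ) := by positivity
    apply mul_le_mul hθ (by linarith) (by linarith) (by linarith)
  rw [e1]
  gcongr

/-- The lower tail of the number of cycles. -/
theorem exists_quenchedLaw_numCycles_le_le {p q : ℕ} (hp : 0 < p) (hq : 0 < q)
    (hpq : p.Coprime q) (D : ℝ) (hD : 0 ≤ D) :
    ∃ c₀ > 0, ∃ S : ℝ, ∀ n m : ℕ, ∀ [NeZero n] [NeZero m], S ≤ √(n : ℝ) →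
      |(q * m : ℝ) - p * n| ≤ D * √(n : ℝ) → ∀ c, 0 < c → c ≤ c₀ →
        (quenchedLaw n m).real {ω | (numCycles p q ω : ℝ) ≤ c * √(n : ℝ)} ≤
          Real.exp (-(c * √(n : ℝ))) := by
  set δ := 3 / 4 * Real.exp (-((D + 2) * (D + 4))) with hδ
  have hδ0 : 0 < δ := by positivity
  have hp1 : (1 : ℝ) ≤ p := by exact_mod_cast hp
  have hq1 : (1 : ℝ) ≤ q := by exact_mod_cast hq
  -- `B` is chosen so that `L ≤ B * n`. The value of `κ` below makes `2 * K * w * L ≤ n * m`, using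
  -- `w ≤ 5 * B * √n` and `n ≤ 2 * q * m`.
  set B : ℝ := 2 * p + D with hB
  have hB1 : 1 ≤ B := by linarith
  set κ : ℝ := 1 / (20 * q * B ^ 2) with hκ
  have hκ0 : 0 < κ := by positivity
  have hκ1 : 20 * q * B ^ 2 * κ = 1 := mul_one_div_cancel (by positivity)
  clear_value δ κ B
  -- The Chernoff exponent is at most `c * √n - δ ^ 2 * κ * √n / 4`, which is at most `-c * √n` for
  -- this `c₀`. The threshold `2 / κ` ensures that rounding `κ * √n` down loses at most half; `2 * D
  -- + 2` gives `n ≤ 2 * q * m` and keeps the track slopes in `[0, 1]`.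
  refine ⟨δ ^ 2 * κ / 8, by positivity, max (2 * D + 2) (2 / κ), ?_⟩
  intro n m _ _ hS hm c hc hc₀
  have hn : 0 < n := NeZero.pos n
  have hS1 : 2 * D + 2 ≤ √(n : ℝ) := (le_max_left _ _).trans hS
  have hS2 : 2 / κ ≤ √(n : ℝ) := (le_max_right _ _).trans hS
  set x := √(n : ℝ) with hx
  have hxx : x * x = n := Real.mul_self_sqrt (by positivity)
  have hx1 : 1 ≤ x := by linarith
  set L := p * n + q * m with hL
  have hLr : (L : ℝ) = p * n + q * m := by rw [hL]; push_cast; ring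
  have hmabs := abs_le.1 hm
  have hxn : x ≤ n := by nlinarith
  have hLB : (L : ℝ) ≤ B * n := by
    rw [hLr, hB]
    nlinarith [hmabs.2, mul_le_mul_of_nonneg_left hxn hD]
  have hnL : (n : ℝ) ≤ L := by
    exact_mod_cast (Nat.le_mul_of_pos_left n hp).trans (Nat.le_add_right _ _)
  have hnpos : (0 : ℝ) < n := by exact_mod_cast hn
  have hLpos : (0 : ℝ) < L := hnpos.trans_le hnL
  have hsL : √(L : ℝ) ≤ B * x := by
    rw [Real.sqrt_le_left (by positivity), mul_pow, pow_two x, hxx]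
    refine hLB.trans ?_
    have : B ≤ B ^ 2 := by nlinarith
    gcongr
  have hmn : (n : ℝ) ≤ 2 * q * m := by
    have h1 : 2 * (D * x) ≤ n := by rw [← hxx]; nlinarith
    have h2 : (n : ℝ) ≤ p * n := le_mul_of_one_le_left hnpos.le hp1
    nlinarith [hmabs.1]
  set w := ⌊4 * √(L : ℝ)⌋₊ + 1 with hw
  set K := ⌊κ * x⌋₊ with hK
  have hwle : (w : ℝ) ≤ 5 * B * x := by
    have h1 : (⌊4 * √(L : ℝ)⌋₊ : ℝ) ≤ 4 * √(L : ℝ) := Nat.floor_le (by positivity)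
    rw [hw]
    push_cast
    have h2 : 1 ≤ B * x := one_le_mul_of_one_le_of_one_le hB1 hx1
    linarith
  have hKle : (K : ℝ) ≤ κ * x := Nat.floor_le (by positivity)
  have hKge : κ * x / 2 ≤ K := by
    have h1 : κ * x < K + 1 := Nat.lt_floor_add_one _
    have h2 : 2 ≤ κ * x := by rw [div_le_iff₀ hκ0] at hS2; linarith
    linarith
  have hfit : BlocksFit p q n m w K := by
    refine ⟨?_, ?_⟩
    · rw [← hL, hw]; push_cast; exact Nat.lt_floor_add_one _
    · rw [← hL, le_div_iff₀ hLpos]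
      calc 2 * (K : ℝ) * w * L ≤ 2 * (κ * x) * (5 * B * x) * (B * n) := by gcongr
        _ = 10 * B ^ 2 * κ * (x * x) * n := by ring
        _ ≤ 10 * B ^ 2 * κ * (2 * q * m) * n := by rw [hxx]; gcongr
        _ = (20 * q * B ^ 2 * κ) * (n * m) := by ring
        _ = n * m := by rw [hκ1, one_mul]
  have hprob : δ ^ 2 ≤ blockProb p q n m := by
    have h1 := fun s => le_trackSteps_card (p := p) (q := q) (n := n) (m := m) hp hn hD hm
      (by linarith) s
    calc δ ^ 2 = ∏ _s : Bool, δ := by simp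
      _ ≤ _ := Finset.prod_le_prod (fun _ _ => hδ0.le) fun s _ => hδ.le.trans (h1 s)
  classical
  have hch := card_events_le_exp (μ := quenchedLaw n m)
    (E := fun j : Fin K => blockEvent p q n m w j) (fun _ => MeasurableSet.of_discrete)
    (hfit.iIndepSet_blockEvent hp hpq) (ε := δ ^ 2)
    (fun j => by rw [hfit.real_blockEvent hp hpq]; exact hprob) (c * x)
  refine (measureReal_mono ?_ (measure_ne_top _ _)).trans (hch.trans ?_)
  · intro ω hω
    refine le_trans ?_ (show (numCycles p q ω : ℝ) ≤ c * x from hω)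
    have := hfit.card_le_numCycles hp hpq ω
    exact_mod_cast this
  · apply Real.exp_le_exp.2
    have h1 : δ ^ 2 * (κ * x / 2) ≤ δ ^ 2 * K := by gcongr
    have h2 : c * x ≤ δ ^ 2 * κ / 8 * x := by gcongr
    linarith

end Parameters

/-! ### Asymptotics of `m` and conclusion -/

theorem eventually_abs_sub_le {p q : ℕ} (hq : 0 < q) {ρ : ℝ} (hρ : 0 < ρ) {m : ℕ → ℕ}
    (h : (fun n : ℕ => (m n : ℝ) - (p / q : ℝ) * n) ~[atTop] (fun n : ℕ => ρ * √(n : ℝ))) :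
    ∀ᶠ n : ℕ in atTop, |(q * m n : ℝ) - p * n| ≤ 2 * q * ρ * √(n : ℝ) := by
  -- The error is eventually at most the main term `ρ * √n`, whence the factor `2`.
  filter_upwards [h.isLittleO.def one_pos] with n hn
  have hq' : (0 : ℝ) < q := by exact_mod_cast hq
  have h0 : 0 ≤ ρ * √(n : ℝ) := by positivity
  rw [Pi.sub_apply, Real.norm_eq_abs, Real.norm_eq_abs, one_mul, abs_of_nonneg h0, abs_le] at hn
  have e : (q * m n : ℝ) - p * n = q * (m n - (p / q : ℝ) * n) := by field_simp
  rw [e, abs_mul, abs_of_pos hq', mul_assoc, mul_assoc, mul_left_comm]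
  gcongr
  rw [abs_le]
  constructor <;> linarith [hn.1, hn.2]

theorem tendsto_sqrt_natCast : Tendsto (fun n : ℕ => √(n : ℝ)) atTop atTop :=
  Real.tendsto_sqrt_atTop.comp tendsto_natCast_atTop_atTop

/-- `ZMod 0` is `ℤ`, so both side lengths must be positive before the torus is finite. -/
theorem pos_of_abs_sub_le {p q n m : ℕ} {D : ℝ} (hp : 0 < p) (hn : D + 1 ≤ √(n : ℝ))
    (hD : 0 ≤ D) (h : |(q * m : ℝ) - p * n| ≤ D * √(n : ℝ)) : 0 < n ∧ 0 < m := by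
  have hx : (√(n : ℝ)) * √(n : ℝ) = n := Real.mul_self_sqrt (by positivity)
  have hn0 : (0 : ℝ) < n := by nlinarith
  refine ⟨by exact_mod_cast hn0, Nat.pos_of_ne_zero fun hm => ?_⟩
  subst hm
  have hp1 : (1 : ℝ) ≤ p := by exact_mod_cast hp
  have h1 := (abs_le.1 h).1
  simp only [Nat.cast_zero, mul_zero, zero_sub] at h1
  nlinarith

theorem mainTheorem8 (p q : ℕ) (hp : 0 < p) (hq : 0 < q) (hpq : Nat.Coprime p q)
    (ρ : ℝ) (hρ : 0 < ρ) :
    (∃ c₀ : ℝ, 0 < c₀ ∧ ∀ c : ℝ, 0 < c → c ≤ c₀ →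
      ∀ m : ℕ → ℕ,
        (fun n : ℕ => (m n : ℝ) - (p / q : ℝ) * n) ~[atTop] (fun n : ℕ => ρ * √(n : ℝ)) →
        ∀ᶠ n : ℕ in atTop,
          1 - Real.exp (-(c * √(n : ℝ))) ≤
            (quenchedLaw n (m n)).real
              {ω | ∀ S : Set (Torus n (m n)), IsCycleOf ω S → HasHomologyClass ω S p q} ∧
          1 - Real.exp (-(c * √(n : ℝ))) ≤
            (quenchedLaw n (m n)).real {ω | c * √(n : ℝ) < (numCycles p q ω : ℝ)}) ∧
    (∃ C₀ : ℝ, 0 < C₀ ∧ ∀ C : ℝ, C₀ ≤ C →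
      ∀ m : ℕ → ℕ,
        (fun n : ℕ => (m n : ℝ) - (p / q : ℝ) * n) ~[atTop] (fun n : ℕ => ρ * √(n : ℝ)) →
        ∀ᶠ n : ℕ in atTop,
          (quenchedLaw n (m n)).real {ω | C * √(n : ℝ) < (numCycles p q ω : ℝ)} ≤
            Real.exp (-(C⁻¹ * √(n : ℝ)))) := by
  set D : ℝ := 2 * q * ρ with hDdef
  have hD : 0 ≤ D := by positivity
  constructor
  · obtain ⟨c₀, hc₀, S, hS⟩ := exists_quenchedLaw_numCycles_le_le hp hq hpq D hD
    refine ⟨c₀, hc₀, fun c hc hcc m hm => ?_⟩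
    filter_upwards [eventually_abs_sub_le hq hρ hm, tendsto_sqrt_natCast.eventually_ge_atTop S,
      tendsto_sqrt_natCast.eventually_ge_atTop (D + 1)] with n h1 h2 h3
    obtain ⟨hn, hm0⟩ := pos_of_abs_sub_le hp h3 hD h1
    have : NeZero n := ⟨hn.ne'⟩
    have : NeZero (m n) := ⟨hm0.ne'⟩
    have hlow := hS n (m n) h2 h1 c hc hcc
    have hcompl : {ω : EdgeChoice n (m n) | c * √(n : ℝ) < (numCycles p q ω : ℝ)} =
        {ω | (numCycles p q ω : ℝ) ≤ c * √(n : ℝ)}ᶜ := by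
      ext ω; simp
    have hmany : 1 - Real.exp (-(c * √(n : ℝ))) ≤
        (quenchedLaw n (m n)).real {ω | c * √(n : ℝ) < (numCycles p q ω : ℝ)} := by
      rw [hcompl, probReal_compl_eq_one_sub MeasurableSet.of_discrete]
      linarith
    refine ⟨hmany.trans (measureReal_mono ?_ (measure_ne_top _ _)), hmany⟩
    -- More than `c * √n` cycles of class `(p, q)` means at least one, and one fixes the class of
    -- every cycle.
    intro ω hω S hScyc
    have hpos : (0 : ℝ) < numCycles p q ω := lt_of_le_of_lt (by positivity) hω
    have hpos' : 0 < numCycles p q ω := by exact_mod_cast hpos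
    obtain ⟨S', hS', hclass⟩ := Set.nonempty_of_ncard_ne_zero hpos'.ne'
    obtain ⟨y, hy, -⟩ := exists_closesUp_of_hasHomologyClass hp hS' hclass
    exact hy.forall_hasHomologyClass hp hq hpq hScyc
  -- Here `M = p + D`, from `m ≤ q * m ≤ p * n + D * √n ≤ (p + D) * n`.
  · refine ⟨max (2 * Real.exp 2 * (p + D)) 1, by positivity, fun C hC m hm => ?_⟩
    filter_upwards [eventually_abs_sub_le hq hρ hm,
      tendsto_sqrt_natCast.eventually_ge_atTop (D + 1)] with n h1 h3
    obtain ⟨hn, hm0⟩ := pos_of_abs_sub_le hp h3 hD h1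
    have : NeZero n := ⟨hn.ne'⟩
    have : NeZero (m n) := ⟨hm0.ne'⟩
    refine quenchedLaw_numCycles_gt_le hp hpq (M := p + D) ?_ ((le_max_left _ _).trans hC)
      ((le_max_right _ _).trans hC)
    have hx : (√(n : ℝ)) * √(n : ℝ) = n := Real.mul_self_sqrt (by positivity)
    have hq1 : (1 : ℝ) ≤ q := by exact_mod_cast hq
    have hxn : √(n : ℝ) ≤ n := by nlinarith
    have h4 : (m n : ℝ) ≤ q * m n := le_mul_of_one_le_left (by positivity) hq1
    have h5 : D * √(n : ℝ) ≤ D * n := by gcongr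
    linarith [(abs_le.1 h1).2]
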